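/- Define $I_0(x)=x^2$, $I_1(x)=1-(1-x)^2$, $I_2(x)=\sqrt{x}$ and $I_3(x)=1-\sqrt{1-x}$ on $[0,1]$, and for a quaternary string $w=w_1w_2\cdots w_n\in\{0,1,2,3\}^n$ let $I_w(x)=I_{w_2\cdots w_n}(I_{w_1}(x))$, where the empty string gives the identity. The letters $0,2$ are inverse to each other, and so are $1,3$; $q^{-1}$ is the reversed string of inverse letters. For strings $p,q$ let $w=pq^{-1}$ and $\varphi(x)=I_w(x)-x$. Eliminate the square roots of $\varphi$ one after the other, the outermost first, each time replacing an expression $H(x,\sqrt{\psi})$, where $H$ is a bivariate polynomial, by $H(x,\sqrt{\psi})\cdot H(x,-\sqrt{\psi})$. The result is a polynomial $P\in\mathbb{Z}[x]$, the product $\prod_\sigma\varphi^\sigma$ of the conjugates of $\varphi$ over all choices $\sigma$ of signs of the square roots. Let $f\in\mathbb{Z}[x]$ be the product of those $\varphi^\sigma$ that are not identically zero; precisely, $f$ is the coefficient of the lowest power of $T$ that occurs in $\prod_\sigma(\varphi^\sigma(x)-T)\in\mathbb{Z}[x][T]$ (this fixes the sign of $f$). Then the following hold. 1. For every function $s:\mathbb{C}\to\mathbb{C}$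 with $s(z)^2=z$ for all $z$: if $\xi\in\mathbb{C}$ is a root of $\varphi$, extended to $\mathbb{C}$ by using $s$ for the square root, then $P(\xi)=0$. 2. If $P\neq 0$, then $f=P$. 3. $f\neq 0$, and if $\varphi$ is not identically zero on $[0,1]$, then $f$ vanishes at every root of $\varphi$ in $[0,1]$. 4. There are terminating algorithms (computable functions) for each of the following tasks: (a) given $p,q$, compute the list of coefficients of $f$; (b) given the coefficients of a nonzero $g\in\mathbb{Z}[x]$, isolate the roots of $g$ in $[0,1]$, that is, list in ascending order disjoint open intervals with rational endpoints that are not roots of $g$, such that each interval contains exactly one root of $g$, this root is in $[0,1]$, and every root of $g$ in $[0,1]$ is in one of the intervals; (c) given a string $w$ and a rational $r\in[0,1]$, decide whether $I_w(r)-r\ge 0$. 5. Consider the procedure that, given $p,q$, computes $f$, isolates the roots of $f$ in $[0,1]$, and answers TRUE if and only if $I_{pq^{-1}}(r)-r\ge 0$ for all those endpoints $r$ of the isolating intervals that lie in $[0,1]$. Whichever algorithms with the properties in (b) and (c) are used, this procedure is a terminating algorithm, and for all quaternary strings $p,q$ it answers TRUE if and only if $I_p(x)\ge I_q(x)$ for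 all $x\in[0,1]$. -/

import Mathlib

open Polynomial

/-- Quaternary strings, written with the letters `0, 1, 2, 3`. -/
abbrev QString : Type := List (Fin 4)

/-- The four letters as functions on `[0, 1]`: `I_0(x) = x²`, `I_1(x) = 1 - (1 - x)²`,
`I_2(x) = √x`, `I_3(x) = 1 - √(1 - x)`. -/
noncomputable def letterFun : Fin 4 → ℝ → ℝ
  | 0, x => x ^ 2
  | 1, x => 1 - (1 - x) ^ 2
  | 2, x => Real.sqrt x
  | 3, x => 1 - Real.sqrt (1 - x)

/-- `I_{q₁ q₂ ⋯ qₙ}(x) = I_{q₂ ⋯ qₙ}(I_{q₁}(x))`; the empty string is the identity. -/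
noncomputable def stringFun : QString → ℝ → ℝ
  | [], x => x
  | c :: w, x => stringFun w (letterFun c x)

/-- The extension of `I_c` to `ℂ` that uses `s` to select a square root. -/
def letterFunC (s : ℂ → ℂ) : Fin 4 → ℂ → ℂ
  | 0, x => x ^ 2
  | 1, x => 1 - (1 - x) ^ 2
  | 2, x => s x
  | 3, x => 1 - s (1 - x)

/-- The extension of `I_w` to `ℂ` that uses `s` to select square roots. -/
def stringFunC (s : ℂ → ℂ) : QString → ℂ → ℂ
  | [], x => x
  | c :: w, x => stringFunC s w (letterFunC s c x)

/-- The inverse letter: `0` and `2` are inverse to each other, and so are `1` and `3`. -/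
def letterInv : Fin 4 → Fin 4
  | 0 => 2
  | 1 => 3
  | 2 => 0
  | 3 => 1

/-- The string `p q⁻¹`. -/
def mulInv (p q : QString) : QString := p ++ q.reverse.map letterInv

/-! ### Elimination of square roots

In `H : ℤ[X][X]` the inner variable is the `x` that stays and the outer variable is `y`. -/

/-- The product `H(x, √z) · H(x, -√z)`, as a polynomial in `x` and `z`. The product
`H(x, y) · H(x, -y)` is even in `y`, and `contract 2` puts `z` for `y²`. -/
noncomputable def conjProd (H : ℤ[X][X]) : ℤ[X][X] := contract 2 (H * H.comp (-X))

/-- From `H(x, y)` to the polynomial in `x` and `z` obtained by inserting `y = I_c(z)`. If `I_c`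
has a square root, the result is multiplied with its conjugate. -/
noncomputable def elimLetter : Fin 4 → ℤ[X][X] → ℤ[X][X]
  | 0, H => H.comp (X ^ 2)
  | 1, H => H.comp (1 - (1 - X) ^ 2)
  | 2, H => conjProd H
  | 3, H => (conjProd (H.comp (1 - X))).comp (1 - X)

/-- Start with `H(x, y) = y - x`, where `y` stands for `I_w(z)`, and eliminate the letters of `w`,
the last letter first. The result is the product of all `I_w^σ(z) - x`, where `σ` runs over the
sign choices for the square roots in `I_w`. -/
noncomputable def elim : QString → ℤ[X][X]
  | [] => X - C X
  | c :: w => elimLetter c (elim w)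

/-- The product of all conjugates of `I_w(x) - x`. -/
noncomputable def conjugateProduct (w : QString) : ℤ[X] := (elim w).eval X

/-- `∏ σ, (φ^σ(x) - T)` for `φ(x) = I_w(x) - x`; the outer variable is `T`. -/
noncomputable def conjugatePoly (w : QString) : ℤ[X][X] :=
  (elim w).eval₂ (aeval (C X + X : ℤ[X][X]) : ℤ[X] →ₐ[ℤ] ℤ[X][X]).toRingHom (C X)

/-- The polynomial `f`: up to sign, the product of those conjugates of `I_w(x) - x` that are not
identically zero. It is the coefficient of the lowest power of `T` that occurs in
`∏ σ, (φ^σ(x) - T)`; if no conjugate vanishes identically, this is the constant coefficient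
`∏ σ, φ^σ(x)`. -/
noncomputable def rootPoly (w : QString) : ℤ[X] := (conjugatePoly w).trailingCoeff

/-! ### Isolation of roots and signs -/

/-- A pair `(n, d)` stands for the rational number `n / (d + 1)`. -/
abbrev Frac : Type := ℤ × ℕ

/-- The real number `n / (d + 1)`. -/
noncomputable def Frac.toReal (r : Frac) : ℝ := (r.1 : ℝ) / ((r.2 : ℝ) + 1)

/-- Whether `n / (d + 1)` is in `[0, 1]`. -/
def Frac.inUnit (r : Frac) : Bool := decide (0 ≤ r.1) && decide (r.1 ≤ (r.2 : ℤ) + 1)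

/-- `l` isolates the roots of `g` in `[0, 1]`: it lists, in ascending order, disjoint open
intervals with rational endpoints that are not roots of `g`; each of them contains exactly one
root of `g`, and this root is in `[0, 1]`; each root of `g` in `[0, 1]` is in one of them. -/
structure IsIsolation (g : ℤ[X]) (l : List (Frac × Frac)) : Prop where
  disjoint : l.Pairwise fun J K => J.2.toReal ≤ K.1.toReal
  endpoints : ∀ J ∈ l, aeval J.1.toReal g ≠ 0 ∧ aeval J.2.toReal g ≠ 0
  root : ∀ J ∈ l, ∃ ξ ∈ Set.Icc (0 : ℝ) 1,
    {x ∈ Set.Ioo J.1.toReal J.2.toReal | aeval x g = 0} = {ξ}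
  cover : ∀ ξ ∈ Set.Icc (0 : ℝ) 1, aeval ξ g = 0 →
    ∃ J ∈ l, ξ ∈ Set.Ioo J.1.toReal J.2.toReal

/-- `iso` is a terminating root-isolating algorithm. A polynomial is given to it by its
coefficients. -/
def IsRootIsolator (iso : List ℤ → List (Frac × Frac)) : Prop :=
  Computable iso ∧ ∀ g : ℤ[X], g ≠ 0 → IsIsolation g (iso g.coeffList)

/-- `sgn` is a terminating algorithm that decides whether `I_w(r) - r ≥ 0` for a string `w` and a
rational number `r` in `[0, 1]`. -/
def IsSignTest (sgn : QString → Frac → Bool) : Prop :=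
  Computable₂ sgn ∧ ∀ (w : QString) (r : Frac), r.toReal ∈ Set.Icc (0 : ℝ) 1 →
    (sgn w r = true ↔ 0 ≤ stringFun w r.toReal - r.toReal)

/-- The procedure: form `w = p q⁻¹`, compute `f`, isolate the roots of `f` in `[0, 1]`, and check
the sign of `I_w(x) - x` at those endpoints of the isolating intervals that lie in `[0, 1]`. -/
noncomputable def procedure (iso : List ℤ → List (Frac × Frac)) (sgn : QString → Frac → Bool)
    (p q : QString) : Bool :=
  ((iso (rootPoly (mulInv p q)).coeffList).flatMap fun J => [J.1, J.2]).all
    fun r => !r.inUnit || sgn (mulInv p q) r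

/-! Write φ(x) = I_w(x) - x with w = pq⁻¹. Applying the increasing function I_{q⁻¹} shows that φ ≥ 0
at x if and only if I_p ≥ I_q there (`stringFun_mulInv_le_iff`).

The polynomial Q(x, T) = ∏ (φ^σ(x) - T) is nonzero, because at x = 0 each factor is a constant minus
T. Write Q = T^m · g with g(x, 0) = f. Since Q(x, φ(x)) = 0 on [0, 1], g(x, φ(x)) vanishes wherever
φ does not. By analyticity on (0, 1), either φ vanishes identically or these points are dense. In
the latter case continuity gives g(ξ, φ(ξ)) = 0 on all of [0, 1], and f(ξ) = 0 at each root ξ of φ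
(`aeval_rootPoly`).

As φ(0) = φ(1) = 0, a point with φ < 0 lies between two neighbouring roots a < b of φ. Both are
roots of f, so they lie in different isolating intervals, and the right endpoint of the one around a
lies in (a, b), where φ < 0 (`IsIsolation.exists_neg`).

Effectivity: f is primitive recursive through codes of polynomials by coefficient lists. Isolation
and sign test are unbounded searches for certificates that can be checked primitive recursively
(`exists_computable_of_test`). For the sign, I_w(r) > s is certified by a chain of rational lower
bounds, and I_w(r) < r is the same as I_{w⁻¹}(r) > r. The inequality I_w(r) ≥ r becomes strict after
lowering r by less than a bound for the nonzero roots of Q(r, T) (`signThreshold_lt_iff`). For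
isolation, a polynomial h with the same roots as g is sought, together with a grid on each cell of
which h has no root or is strictly monotone; a squarefree h admits such a grid (`exists_gridTest`).
-/

/-! ### Primitive recursive arithmetic on integers -/

namespace Primrec

/-- The encoding of ℤ maps n to 2n and `Int.negSucc n` to 2n + 1. -/
theorem int_ofNat : Primrec (fun n : ℕ => (n : ℤ)) :=
  encode_iff.1 (nat_double.of_eq fun _ => rfl)

theorem int_negSucc : Primrec Int.negSucc :=
  encode_iff.1 (nat_double_succ.of_eq fun _ => rfl)

theorem int_toNat : Primrec Int.toNat := by
  have h : Primrec fun z : ℤ => bif (Encodable.encode z).bodd then 0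
      else (Encodable.encode z).div2 :=
    Primrec.cond (nat_bodd.comp Primrec.encode) (.const 0) (nat_div2.comp Primrec.encode)
  refine h.of_eq fun z => ?_
  cases z with
  | ofNat n =>
    have : Encodable.encode (n : ℤ) = 2 * n := rfl
    simp [this, Nat.div2_val]
  | negSucc n =>
    have : Encodable.encode (Int.negSucc n) = 2 * n + 1 := rfl
    simp [this]

theorem int_natAbs : Primrec Int.natAbs := by
  have h : Primrec fun z : ℤ => bif (Encodable.encode z).bodd then (Encodable.encode z).div2 + 1
      else (Encodable.encode z).div2 :=
    Primrec.cond (nat_bodd.comp Primrec.encode)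
      (succ.comp (nat_div2.comp Primrec.encode)) (nat_div2.comp Primrec.encode)
  refine h.of_eq fun z => ?_
  cases z with
  | ofNat n =>
    have : Encodable.encode (n : ℤ) = 2 * n := rfl
    simp [this, Nat.div2_val]
  | negSucc n =>
    have : Encodable.encode (Int.negSucc n) = 2 * n + 1 := rfl
    simp [this, Nat.div2_val]

theorem int_natSub : Primrec₂ (fun m n : ℕ => (m : ℤ) - n) := by
  have h : Primrec fun p : ℕ × ℕ => if p.2 ≤ p.1 then ((p.1 - p.2 : ℕ) : ℤ)
      else Int.negSucc (p.2 - p.1).pred :=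
    Primrec.ite (nat_le.comp snd fst) (int_ofNat.comp (nat_sub.comp fst snd))
      (int_negSucc.comp (pred.comp (nat_sub.comp snd fst)))
  refine h.of_eq fun p => ?_
  split_ifs with hp
  · dsimp only
    omega
  · simp only [Nat.pred_eq_sub_one]
    omega

theorem int_negToNat : Primrec (fun z : ℤ => (-z).toNat) :=
  (nat_sub.comp int_natAbs int_toNat).of_eq fun z => by omega

theorem int_neg : Primrec (fun z : ℤ => -z) :=
  (int_natSub.comp int_negToNat int_toNat).of_eq fun z => by omega

/-- Each integer z is the difference of the natural numbers `z.toNat` and `(-z).toNat`, so sums and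
products reduce to arithmetic in ℕ and one final difference. -/
theorem int_add : Primrec₂ (fun x y : ℤ => x + y) := by
  have h := int_natSub.comp
    (nat_add.comp (int_toNat.comp (fst (α := ℤ) (β := ℤ))) (int_toNat.comp snd))
    (nat_add.comp (int_negToNat.comp (fst (α := ℤ) (β := ℤ))) (int_negToNat.comp snd))
  exact h.of_eq fun p => by dsimp only; omega

theorem int_mul : Primrec₂ (fun x y : ℤ => x * y) := by
  have a := int_toNat.comp (fst (α := ℤ) (β := ℤ))
  have b := int_toNat.comp (snd (α := ℤ) (β := ℤ))
  have c := int_negToNat.comp (fst (α := ℤ) (β := ℤ))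
  have d := int_negToNat.comp (snd (α := ℤ) (β := ℤ))
  have h := int_natSub.comp (nat_add.comp (nat_mul.comp a b) (nat_mul.comp c d))
    (nat_add.comp (nat_mul.comp a d) (nat_mul.comp c b))
  refine h.of_eq fun p => ?_
  have h1 : p.1 = p.1.toNat - (-p.1).toNat := by omega
  have h2 : p.2 = p.2.toNat - (-p.2).toNat := by omega
  conv_rhs => rw [h1, h2]
  push_cast
  ring

theorem int_le : PrimrecRel (fun x y : ℤ => x ≤ y) := by
  have h := PrimrecRel.comp nat_le (int_toNat.comp
    (int_add.comp (fst (α := ℤ) (β := ℤ)) (int_neg.comp snd))) (.const 0)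
  exact h.of_eq fun p => by omega

theorem int_eq_zero : PrimrecPred (fun z : ℤ => z = 0) :=
  (PrimrecRel.comp Primrec.eq int_natAbs (.const 0)).of_eq fun z => by omega

theorem list_all {α β : Type*} [Primcodable α] [Primcodable β] {f : α → List β} {p : α → β → Bool}
    (hf : Primrec f) (hp : Primrec₂ p) : Primrec fun a => (f a).all (p a) := by
  have h : Primrec fun a => (f a).foldr (fun b r => p a b && r) true :=
    list_foldr hf (.const true)
      (Primrec.and.comp (hp.comp fst (fst.comp snd)) (snd.comp snd)).to₂
  refine h.of_eq fun a => ?_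
  induction f a with
  | nil => rfl
  | cons b l ih => simp [ih]

theorem list_filter {α β : Type*} [Primcodable α] [Primcodable β] {f : α → List β}
    {p : α → β → Bool} (hf : Primrec f) (hp : Primrec₂ p) :
    Primrec fun a => (f a).filter (p a) := by
  have h : Primrec fun a => (f a).foldr (fun b r => bif p a b then b :: r else r) [] :=
    list_foldr hf (.const [])
      (Primrec.cond (hp.comp fst (fst.comp snd))
        (list_cons.comp (fst.comp snd) (snd.comp snd)) (snd.comp snd)).to₂
  refine h.of_eq fun a => ?_
  induction f a with
  | nil => rfl
  | cons b l ih => cases hb : p a b <;> simp [ih, hb]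

end Primrec

/-! ### Bounded conjunction and unbounded search -/

theorem Computable.list_all {α β : Type*} [Primcodable α] [Primcodable β] {f : α → List β}
    {p : α → β → Bool} (hf : Computable f) (hp : Computable₂ p) :
    Computable fun a => (f a).all (p a) := by
  -- The test `p` is only computable, so the list is traversed by recursion on the index; the value
  -- `true` for an index out of range is neutral.
  have step : Computable₂ fun (a : α) (s : ℕ × Bool) =>
      s.2 && ((f a)[s.1]?.casesOn true (p a) : Bool) := by
    refine (Primrec.and.to_comp.comp (snd.comp snd) (Computable.option_casesOn
      (o := fun x : α × (ℕ × Bool) => (f x.1)[x.2.1]?)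
      (list_getElem?.comp (hf.comp fst) (fst.comp snd)) (.const true)
      (hp.comp (fst.comp fst) snd).to₂)).to₂
  have h := Computable.nat_rec (list_length.comp hf) (.const true) step
  refine h.of_eq fun a => ?_
  have key : ∀ n, (Nat.rec true (fun k r => r && ((f a)[k]?.casesOn true (p a) : Bool)) n : Bool) =
      ((f a).take n).all (p a) := by
    intro n
    induction n with
    | zero => simp
    | succ n ih =>
      simp only [ih, List.take_add_one, List.all_append]
      cases (f a)[n]? <;> simp
  simpa using key (f a).length

/-- A total relation with a computable test is uniformized by a computable function. -/
theorem exists_computable_of_test {α β : Type*} [Primcodable α] [Primcodable β]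
    {R : α → β → Bool} (hR : Computable₂ R) (h : ∀ a, ∃ b, R a b = true) :
    ∃ f : α → β, Computable f ∧ ∀ a, R a (f a) = true := by
  choose b hb using h
  let g : α → ℕ → Option β := fun a n =>
    (Encodable.decode (α := β) n).bind fun b => bif R a b then some b else none
  have hg : Computable₂ g :=
    (Computable.option_bind (Computable.decode.comp Computable.snd)
      (Computable.cond (hR.comp (Computable.fst.comp Computable.fst) Computable.snd)
        (Computable.option_some.comp Computable.snd) (.const none)).to₂).to₂
  have spec : ∀ a b, (∃ n, b ∈ g a n) → R a b = true := by
    rintro a b ⟨n, hn⟩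
    simp only [g, Option.mem_def, Option.bind_eq_some_iff] at hn
    obtain ⟨c, -, hc⟩ := hn
    cases hRc : R a c <;> simp_all
  -- The chosen witnesses serve only to show that the search through all codes halts; they do not
  -- enter the function.
  have dom : ∀ a, (Nat.rfindOpt (g a)).Dom := fun a =>
    Nat.rfindOpt_dom.2 ⟨Encodable.encode (b a), b a, by simp [g, hb a]⟩
  refine ⟨fun a => (Nat.rfindOpt (g a)).get (dom a), (Partrec.rfindOpt hg).of_eq_tot
    fun a => Part.get_mem _, fun a => spec a _ (Nat.rfindOpt_spec (Part.get_mem _))⟩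

/-! ### Rings with primitive recursive operations on codes -/

/-- A coding of elements of the ring `R` by elements of `A`, with primitive recursive ring
operations and a primitive recursive test for zero. -/
structure RingCode (A R : Type*) [Primcodable A] [CommRing R] where
  /-- The element with a given code. -/
  dec : A → R
  /-- A code of `0`. -/
  zero : A
  /-- A code of `1`. -/
  one : A
  /-- Addition of codes. -/
  add : A → A → A
  /-- Negation of codes. -/
  neg : A → A
  /-- Multiplication of codes. -/
  mul : A → A → A
  /-- Test for zero. -/
  isZero : A → Bool
  dec_zero : dec zero = 0
  dec_one : dec one = 1
  dec_add : ∀ a b, dec (add a b) = dec a + dec b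
  dec_neg : ∀ a, dec (neg a) = -dec a
  dec_mul : ∀ a b, dec (mul a b) = dec a * dec b
  isZero_iff : ∀ a, isZero a = true ↔ dec a = 0
  primrec_add : Primrec₂ add
  primrec_neg : Primrec neg
  primrec_mul : Primrec₂ mul
  primrec_isZero : Primrec isZero

namespace RingCode

variable {A B R S γ : Type*} [Primcodable A] [Primcodable B] [Primcodable γ] [CommRing R]
  [CommRing S]

section Poly

variable (c : RingCode A R)

/-- The polynomial with a given list of codes of coefficients, the constant coefficient first. -/
noncomputable def polyDec (l : List A) : R[X] := l.foldr (fun a p => C (c.dec a) + X * p) 0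

@[simp] theorem polyDec_nil : c.polyDec [] = 0 := rfl

@[simp] theorem polyDec_cons (a : A) (l : List A) :
    c.polyDec (a :: l) = C (c.dec a) + X * c.polyDec l := rfl

theorem coeff_polyDec (l : List A) (n : ℕ) :
    (c.polyDec l).coeff n = c.dec (l.getD n c.zero) := by
  induction l generalizing n with
  | nil => simp [c.dec_zero]
  | cons a l ih => cases n <;> simp [ih]

/-- Addition of coefficient lists. -/
def polyAdd (l m : List A) : List A :=
  (List.range (max l.length m.length)).map fun i => c.add (l.getD i c.zero) (m.getD i c.zero)

/-- Multiplication of coefficient lists. -/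
def polyMul (l m : List A) : List A :=
  l.foldr (fun a r => c.polyAdd (m.map (c.mul a)) (c.zero :: r)) []

omit [Primcodable A] in
theorem getD_map_range (f : ℕ → A) (n i : ℕ) (d : A) :
    ((List.range n).map f).getD i d = if i < n then f i else d := by
  split_ifs with h <;> simp [h]

theorem polyDec_polyAdd (l m : List A) :
    c.polyDec (c.polyAdd l m) = c.polyDec l + c.polyDec m := by
  ext n
  rw [coeff_add, coeff_polyDec, coeff_polyDec, coeff_polyDec, polyAdd, getD_map_range]
  split_ifs with h
  · rw [c.dec_add]
  · rw [not_lt, max_le_iff] at h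
    rw [List.getD_eq_default _ _ h.1, List.getD_eq_default _ _ h.2, c.dec_zero, add_zero]

theorem polyDec_map {d : RingCode B S} {f : A → B} {η : R →+* S}
    (h : ∀ a, d.dec (f a) = η (c.dec a)) (l : List A) :
    d.polyDec (l.map f) = (c.polyDec l).map η := by
  induction l with
  | nil => simp
  | cons a l ih => simp [ih, h]

theorem polyDec_map_smul {f : A → A} {r : R} (h : ∀ a, c.dec (f a) = r * c.dec a) (l : List A) :
    c.polyDec (l.map f) = C r * c.polyDec l := by
  induction l with
  | nil => simp
  | cons a l ih =>
    simp only [List.map_cons, polyDec_cons, ih, h, C_mul]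
    ring

theorem polyDec_polyMul (l m : List A) :
    c.polyDec (c.polyMul l m) = c.polyDec l * c.polyDec m := by
  induction l with
  | nil => simp [polyMul]
  | cons a l ih =>
    have : c.polyMul (a :: l) m = c.polyAdd (m.map (c.mul a)) (c.zero :: c.polyMul l m) := rfl
    rw [this, polyDec_polyAdd, polyDec_cons, ih, polyDec_cons, c.dec_zero,
      c.polyDec_map_smul (c.dec_mul a)]
    simp only [C_0]
    ring

theorem polyDec_all_isZero (l : List A) : l.all c.isZero = true ↔ c.polyDec l = 0 := by
  induction l with
  | nil => simp
  | cons a l ih =>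
    rw [List.all_cons, Bool.and_eq_true, ih, c.isZero_iff, polyDec_cons]
    constructor
    · rintro ⟨h1, h2⟩
      simp [h1, h2]
    · intro h
      have h0 : c.dec a = 0 := by simpa using congrArg (fun p => coeff p 0) h
      refine ⟨h0, ?_⟩
      ext n
      simpa using congrArg (fun p => coeff p (n + 1)) h

theorem primrec_polyAdd : Primrec₂ c.polyAdd := by
  have hlen : Primrec fun p : List A × List A => max p.1.length p.2.length :=
    Primrec.nat_max.comp (Primrec.list_length.comp Primrec.fst)
      (Primrec.list_length.comp Primrec.snd)
  exact Primrec.list_map (Primrec.list_range.comp hlen)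
    (c.primrec_add.comp
      ((Primrec.list_getD c.zero).comp (Primrec.fst.comp Primrec.fst) Primrec.snd)
      ((Primrec.list_getD c.zero).comp (Primrec.snd.comp Primrec.fst) Primrec.snd)).to₂

theorem primrec_polyMul : Primrec₂ c.polyMul := by
  refine Primrec.list_foldr (f := fun p : List A × List A => p.1) (g := fun _ => [])
    (h := fun p q => c.polyAdd (p.2.map (c.mul q.1)) (c.zero :: q.2))
    Primrec.fst (.const []) (Primrec₂.comp c.primrec_polyAdd ?_ ?_)
  · exact Primrec.list_map (Primrec.snd.comp Primrec.fst)
      (c.primrec_mul.comp (Primrec.fst.comp (Primrec.snd.comp Primrec.fst)) Primrec.snd).to₂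
  · exact Primrec.list_cons.comp (.const c.zero) (Primrec.snd.comp Primrec.snd)

/-- The coding of polynomials by coefficient lists. -/
noncomputable def poly : RingCode (List A) R[X] where
  dec := c.polyDec
  zero := []
  one := [c.one]
  add := c.polyAdd
  neg := List.map c.neg
  mul := c.polyMul
  isZero l := l.all c.isZero
  dec_zero := rfl
  dec_one := by simp [c.dec_one]
  dec_add := c.polyDec_polyAdd
  dec_neg l := by
    rw [c.polyDec_map_smul (r := -1) (fun a => by rw [c.dec_neg, neg_one_mul])]
    simp
  dec_mul := c.polyDec_polyMul
  isZero_iff := c.polyDec_all_isZero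
  primrec_add := c.primrec_polyAdd
  primrec_neg := Primrec.list_map Primrec.id (c.primrec_neg.comp Primrec.snd).to₂
  primrec_mul := c.primrec_polyMul
  primrec_isZero := Primrec.list_all Primrec.id (c.primrec_isZero.comp Primrec.snd).to₂

theorem poly_dec (l : List A) : c.poly.dec l = c.polyDec l := rfl

/-- Evaluation of coefficient lists by Horner's rule; `h` is applied to the coefficients. -/
def horner (h : B → A) (x : A) (l : List B) : A :=
  l.foldr (fun b r => c.add (h b) (c.mul x r)) c.zero

theorem dec_horner {d : RingCode B S} {η : S →+* R} {h : B → A}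
    (hh : ∀ b, c.dec (h b) = η (d.dec b)) (x : A) (l : List B) :
    c.dec (c.horner h x l) = (d.polyDec l).eval₂ η (c.dec x) := by
  induction l with
  | nil => simp [horner, c.dec_zero]
  | cons b l ih =>
    have : c.horner h x (b :: l) = c.add (h b) (c.mul x (c.horner h x l)) := rfl
    rw [this, c.dec_add, c.dec_mul, ih, hh]
    simp

theorem primrec_horner {h : γ → B → A} {x : γ → A} {l : γ → List B} (hh : Primrec₂ h)
    (hx : Primrec x) (hl : Primrec l) : Primrec fun g => c.horner (h g) (x g) (l g) :=
  Primrec.list_foldr hl (.const c.zero)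
    (c.primrec_add.comp (hh.comp Primrec.fst (Primrec.fst.comp Primrec.snd))
      (c.primrec_mul.comp (hx.comp Primrec.fst) (Primrec.snd.comp Primrec.snd))).to₂

/-- The value of a polynomial. -/
def evalCode (x : A) (l : List A) : A := c.horner id x l

theorem dec_evalCode (x : A) (l : List A) :
    c.dec (c.evalCode x l) = (c.polyDec l).eval (c.dec x) :=
  c.dec_horner (d := c) (η := RingHom.id R) (fun _ => rfl) x l

theorem primrec_evalCode : Primrec₂ c.evalCode :=
  c.primrec_horner (h := fun _ : A × List A => id) Primrec.snd Primrec.fst Primrec.snd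

/-- Composition of polynomials: `compCode m l` is a code of `l ∘ m`. -/
noncomputable def compCode (m l : List A) : List A := c.poly.horner (fun a => [a]) m l

theorem polyDec_compCode (m l : List A) :
    c.polyDec (c.compCode m l) = (c.polyDec l).comp (c.polyDec m) :=
  c.poly.dec_horner (d := c) (η := C) (fun a => by simp [poly_dec]) m l

theorem primrec_compCode : Primrec₂ c.compCode :=
  c.poly.primrec_horner (h := fun (_ : List A × List A) a => [a])
    (Primrec.list_cons.comp Primrec.snd (.const [])).to₂ Primrec.fst Primrec.snd

/-- Powers of codes. -/
def powCode (a : A) (n : ℕ) : A := n.rec c.one fun _ r => c.mul a r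

theorem dec_powCode (a : A) (n : ℕ) : c.dec (c.powCode a n) = c.dec a ^ n := by
  induction n with
  | zero => exact c.dec_one.trans (pow_zero _).symm
  | succ n ih =>
    rw [pow_succ', ← ih, ← c.dec_mul]
    rfl

theorem primrec_powCode : Primrec₂ c.powCode :=
  Primrec.nat_rec (.const c.one)
    (c.primrec_mul.comp Primrec.fst (Primrec.snd.comp Primrec.snd)).to₂

/-- Equality of the elements with given codes. -/
def eqCode (a b : A) : Bool := c.isZero (c.add a (c.neg b))

theorem eqCode_iff (a b : A) : c.eqCode a b = true ↔ c.dec a = c.dec b := by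
  rw [eqCode, c.isZero_iff, c.dec_add, c.dec_neg, ← sub_eq_add_neg, sub_eq_zero]

theorem primrec_eqCode : Primrec₂ c.eqCode :=
  c.primrec_isZero.comp (c.primrec_add.comp Primrec.fst (c.primrec_neg.comp Primrec.snd))

/-- The coefficients of even degree. -/
def contractCode (l : List A) : List A :=
  (List.range l.length).map fun i => l.getD (i * 2) c.zero

theorem polyDec_contractCode (l : List A) :
    c.polyDec (c.contractCode l) = contract 2 (c.polyDec l) := by
  ext n
  rw [coeff_contract two_ne_zero, coeff_polyDec, coeff_polyDec, contractCode, getD_map_range]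
  split_ifs with h
  · rfl
  · rw [List.getD_eq_default l _ (by omega)]

theorem primrec_contractCode : Primrec c.contractCode :=
  Primrec.list_map (Primrec.list_range.comp Primrec.list_length)
    ((Primrec.list_getD c.zero).comp Primrec.fst
      (Primrec.nat_mul.comp Primrec.snd (.const 2))).to₂

/-- The first nonzero coefficient. -/
def trailingCode (l : List A) : A := l.foldr (fun a r => bif c.isZero a then r else a) c.zero

theorem dec_trailingCode [NoZeroDivisors R] (l : List A) :
    c.dec (c.trailingCode l) = (c.polyDec l).trailingCoeff := by
  induction l with
  | nil => simp [trailingCode, c.dec_zero]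
  | cons a l ih =>
    have : c.trailingCode (a :: l) = bif c.isZero a then c.trailingCode l else a := rfl
    rw [this, polyDec_cons]
    by_cases h : c.dec a = 0
    · have hz : c.isZero a = true := (c.isZero_iff a).2 h
      rw [hz, h, cond_true, ih, C_0, zero_add]
      nontriviality R
      -- Multiplication by `X` shifts the coefficients and leaves the lowest nonzero one unchanged.
      rw [trailingCoeff_mul]
      simp [trailingCoeff]
    · have hz : c.isZero a = false := by
        rw [← Bool.not_eq_true, c.isZero_iff]
        exact h
      rw [hz, cond_false, trailingCoeff]
      have h0 : (C (c.dec a) + X * c.polyDec l).coeff 0 ≠ 0 := by simpa using h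
      rw [natTrailingDegree_eq_zero.2 (Or.inr h0)]
      simp

theorem primrec_trailingCode : Primrec c.trailingCode :=
  Primrec.list_foldr Primrec.id (.const c.zero)
    (Primrec.cond (c.primrec_isZero.comp (Primrec.fst.comp Primrec.snd))
      (Primrec.snd.comp Primrec.snd) (Primrec.fst.comp Primrec.snd)).to₂

/-- A coefficient list together with a coefficient list of the derivative. -/
def derivPair (l : List A) : List A × List A :=
  l.foldr (fun a r => (a :: r.1, c.polyAdd r.1 (c.zero :: r.2))) ([], [])

theorem derivPair_fst (l : List A) : (c.derivPair l).1 = l := by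
  induction l with
  | nil => rfl
  | cons a l ih => exact congrArg (a :: ·) ih

/-- The derivative of a polynomial. -/
def derivCode (l : List A) : List A := (c.derivPair l).2

/-- The recursion is (a + X p)' = p + X p'; this is why the fold carries p along with p'. -/
theorem polyDec_derivCode (l : List A) :
    c.polyDec (c.derivCode l) = derivative (c.polyDec l) := by
  induction l with
  | nil => simp [derivCode, derivPair]
  | cons a l ih =>
    have : c.derivCode (a :: l) = c.polyAdd (c.derivPair l).1 (c.zero :: c.derivCode l) := rfl
    rw [this, derivPair_fst, polyDec_polyAdd, polyDec_cons, ih, c.dec_zero]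
    simp

theorem primrec_derivCode : Primrec c.derivCode :=
  Primrec.snd.comp (Primrec.list_foldr Primrec.id (.const ([], []))
    (Primrec.pair
      (Primrec.list_cons.comp (Primrec.fst.comp Primrec.snd)
        (Primrec.fst.comp (Primrec.snd.comp Primrec.snd)))
      (c.primrec_polyAdd.comp (Primrec.fst.comp (Primrec.snd.comp Primrec.snd))
        (Primrec.list_cons.comp (.const c.zero)
          (Primrec.snd.comp (Primrec.snd.comp Primrec.snd))))).to₂)

end Poly

/-- The coding of integers by themselves. -/
def int : RingCode ℤ ℤ where
  dec := id
  zero := 0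
  one := 1
  add := (· + ·)
  neg := (- ·)
  mul := (· * ·)
  isZero z := decide (z = 0)
  dec_zero := rfl
  dec_one := rfl
  dec_add _ _ := rfl
  dec_neg _ := rfl
  dec_mul _ _ := rfl
  isZero_iff _ := by simp
  primrec_add := Primrec.int_add
  primrec_neg := Primrec.int_neg
  primrec_mul := Primrec.int_mul
  primrec_isZero := primrecPred_iff_primrec_decide.1 Primrec.int_eq_zero

@[simp] theorem int_dec (z : ℤ) : int.dec z = z := rfl

theorem exists_polyDec_int (p : ℤ[X]) : ∃ l, int.polyDec l = p := by
  refine ⟨(List.range (p.natDegree + 1)).map p.coeff, ?_⟩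
  ext n
  rw [coeff_polyDec, getD_map_range]
  split_ifs with h
  · rfl
  · exact (coeff_eq_zero_of_natDegree_lt (by omega)).symm

theorem coeffList_C_add_X_mul {p : ℤ[X]} (hp : p ≠ 0) (a : ℤ) :
    (C a + X * p).coeffList = p.coeffList ++ [a] := by
  have hX : (X * p).natDegree = p.natDegree + 1 := by
    rw [natDegree_mul X_ne_zero hp, natDegree_X, add_comm]
  have hdeg : (C a + X * p).natDegree = p.natDegree + 1 := by
    rw [natDegree_add_eq_right_of_natDegree_lt] <;> simp [hX]
  have h0 : C a + X * p ≠ 0 := by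
    intro h
    rw [h, natDegree_zero] at hdeg
    omega
  rw [coeffList, coeffList, withBotSucc_degree_eq_natDegree_add_one h0,
    withBotSucc_degree_eq_natDegree_add_one hp, hdeg, List.range_succ_eq_map]
  simp [List.map_reverse, Function.comp_def, coeff_C, -eq_intCast]

/-- Codes may end in superfluous zeros. Stripping them gives the canonical list, which is what an
isolating algorithm receives. -/
theorem coeffList_polyDec_int (l : List ℤ) :
    (int.polyDec l).coeffList = l.reverse.dropWhile fun z => decide (z = 0) := by
  induction l with
  | nil => simp
  | cons a l ih =>
    rw [polyDec_cons, List.reverse_cons, List.dropWhile_append, ← ih]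
    by_cases h : int.polyDec l = 0
    · by_cases ha : a = 0
      · subst ha
        simp [h]
      · simp [h, ha, coeffList_C ha, -eq_intCast]
    · rw [coeffList_C_add_X_mul h]
      simp [h]

theorem polyDec_reverse_coeffList (p : ℤ[X]) : int.polyDec p.coeffList.reverse = p := by
  obtain ⟨l, rfl⟩ := exists_polyDec_int p
  induction l with
  | nil => simp
  | cons a l ih =>
    rw [polyDec_cons]
    by_cases h : int.polyDec l = 0
    · by_cases ha : a = 0
      · subst ha
        simp [h]
      · simp [h, coeffList_C ha, -eq_intCast]
    · rw [coeffList_C_add_X_mul h]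
      simp [ih]

/-- The coding of real numbers by fractions. -/
noncomputable def frac : RingCode Frac ℝ where
  dec := Frac.toReal
  zero := (0, 0)
  one := (1, 0)
  -- Denominators are stored as their predecessors, hence the final - 1.
  add r s := (r.1 * ((s.2 + 1 : ℕ) : ℤ) + s.1 * ((r.2 + 1 : ℕ) : ℤ), (r.2 + 1) * (s.2 + 1) - 1)
  neg r := (-r.1, r.2)
  mul r s := (r.1 * s.1, (r.2 + 1) * (s.2 + 1) - 1)
  isZero r := decide (r.1 = 0)
  dec_zero := by simp [Frac.toReal]
  dec_one := by simp [Frac.toReal]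
  dec_add r s := by
    have h : (((r.2 + 1) * (s.2 + 1) - 1 : ℕ) : ℝ) = (r.2 + 1) * (s.2 + 1) - 1 := by
      rw [Nat.cast_sub (Nat.succ_le_of_lt (by positivity))]
      push_cast
      ring
    simp only [Frac.toReal, h]
    have h1 : (r.2 : ℝ) + 1 ≠ 0 := by positivity
    have h2 : (s.2 : ℝ) + 1 ≠ 0 := by positivity
    push_cast
    rw [sub_add_cancel]
    field_simp
  dec_neg r := by
    simp only [Frac.toReal]
    push_cast
    ring
  dec_mul r s := by
    have h : (((r.2 + 1) * (s.2 + 1) - 1 : ℕ) : ℝ) = (r.2 + 1) * (s.2 + 1) - 1 := by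
      rw [Nat.cast_sub (Nat.succ_le_of_lt (by positivity))]
      push_cast
      ring
    simp only [Frac.toReal, h]
    have h1 : (r.2 : ℝ) + 1 ≠ 0 := by positivity
    have h2 : (s.2 : ℝ) + 1 ≠ 0 := by positivity
    push_cast
    rw [sub_add_cancel]
    field_simp
  isZero_iff r := by
    have h1 : (r.2 : ℝ) + 1 ≠ 0 := by positivity
    simp [Frac.toReal, h1]
  primrec_add := by
    have a := Primrec.fst.comp (Primrec.fst (α := Frac) (β := Frac))
    have b := Primrec.succ.comp (Primrec.snd.comp (Primrec.fst (α := Frac) (β := Frac)))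
    have c := Primrec.fst.comp (Primrec.snd (α := Frac) (β := Frac))
    have d := Primrec.succ.comp (Primrec.snd.comp (Primrec.snd (α := Frac) (β := Frac)))
    exact Primrec.pair (Primrec.int_add.comp (Primrec.int_mul.comp a (Primrec.int_ofNat.comp d))
      (Primrec.int_mul.comp c (Primrec.int_ofNat.comp b)))
      (Primrec.pred.comp (Primrec.nat_mul.comp b d))
  primrec_neg := Primrec.pair (Primrec.int_neg.comp Primrec.fst) Primrec.snd
  primrec_mul := by
    have a := Primrec.fst.comp (Primrec.fst (α := Frac) (β := Frac))
    have b := Primrec.succ.comp (Primrec.snd.comp (Primrec.fst (α := Frac) (β := Frac)))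
    have c := Primrec.fst.comp (Primrec.snd (α := Frac) (β := Frac))
    have d := Primrec.succ.comp (Primrec.snd.comp (Primrec.snd (α := Frac) (β := Frac)))
    exact Primrec.pair (Primrec.int_mul.comp a c) (Primrec.pred.comp (Primrec.nat_mul.comp b d))
  primrec_isZero := primrecPred_iff_primrec_decide.1 (Primrec.int_eq_zero.comp Primrec.fst)

theorem frac_dec (r : Frac) : frac.dec r = r.toReal := rfl

/-- The comparison of fractions. -/
noncomputable def fracLe (r s : Frac) : Bool := decide (0 ≤ (frac.add s (frac.neg r)).1)

theorem fracLe_iff (r s : Frac) : fracLe r s = true ↔ r.toReal ≤ s.toReal := by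
  have h := frac.dec_add s (frac.neg r)
  rw [frac.dec_neg] at h
  simp only [frac_dec] at h
  rw [fracLe, decide_eq_true_iff, ← sub_nonneg (a := s.toReal), sub_eq_add_neg, ← h]
  set q := frac.add s (frac.neg r)
  have h1 : (0 : ℝ) < (q.2 : ℝ) + 1 := by positivity
  rw [Frac.toReal, le_div_iff₀ h1, zero_mul]
  exact Int.cast_nonneg_iff.symm

theorem primrec_fracLe : Primrec₂ fracLe :=
  primrecPred_iff_primrec_decide.1 (PrimrecRel.comp Primrec.int_le (.const 0)
    (Primrec.fst.comp (frac.primrec_add.comp Primrec.snd (frac.primrec_neg.comp Primrec.fst))))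

end RingCode

/-! ### Elimination of square roots -/

/-- Evenness multiplies the coefficient of degree n by (-1)^n, so the odd ones vanish and `contract
2` loses nothing. -/
theorem expand_contract_two {p : ℤ[X][X]} (hp : p.comp (-X) = p) :
    expand ℤ[X] 2 (contract 2 p) = p := by
  ext1 n
  rw [coeff_expand two_pos]
  split_ifs with h
  · rw [coeff_contract two_ne_zero, Nat.div_mul_cancel h]
  · have hc : p.coeff n = (-1) ^ n * p.coeff n := by
      conv_lhs => rw [← hp]
      have : (-X : ℤ[X][X]) = C (-1) * X := by rw [C_neg, C_1]; ring
      rw [this, comp_C_mul_X_coeff, mul_comm]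
    rw [Odd.neg_one_pow (Nat.not_even_iff_odd.1 fun he => h he.two_dvd), neg_one_mul] at hc
    exact (self_eq_neg.1 hc).symm

section Eval

variable {S : Type*} [CommRing S] (η : ℤ[X] →+* S)

theorem eval₂_comp_eq (H G : ℤ[X][X]) (y : S) :
    (H.comp G).eval₂ η y = H.eval₂ η (G.eval₂ η y) :=
  eval₂_comp η

/-- The target ring is arbitrary since the identity is needed over ℝ, over ℂ and over ℂ[X]. -/
theorem eval₂_conjProd (H : ℤ[X][X]) (y : S) :
    (conjProd H).eval₂ η (y ^ 2) = H.eval₂ η y * H.eval₂ η (-y) := by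
  have h : (H * H.comp (-X)).comp (-X) = H * H.comp (-X) := by
    rw [mul_comp, comp_assoc, neg_comp, X_comp, neg_neg, comp_X, mul_comm]
  have h2 : (H * H.comp (-X)).eval₂ η y = H.eval₂ η y * H.eval₂ η (-y) := by
    rw [eval₂_mul, eval₂_comp_eq, eval₂_neg, eval₂_X]
  rw [← h2, ← expand_contract_two h, expand_eq_comp_X_pow, eval₂_comp_eq, eval₂_pow, eval₂_X]
  rfl

theorem eval₂_elimLetter_zero (H : ℤ[X][X]) (z : S) :
    (elimLetter 0 H).eval₂ η z = H.eval₂ η (z ^ 2) := by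
  change (H.comp (X ^ 2)).eval₂ η z = _
  rw [eval₂_comp_eq, eval₂_pow, eval₂_X]

theorem eval₂_elimLetter_one (H : ℤ[X][X]) (z : S) :
    (elimLetter 1 H).eval₂ η z = H.eval₂ η (1 - (1 - z) ^ 2) := by
  change (H.comp (1 - (1 - X) ^ 2)).eval₂ η z = _
  rw [eval₂_comp_eq, eval₂_sub, eval₂_pow, eval₂_sub, eval₂_X, eval₂_one]

theorem eval₂_elimLetter_two (H : ℤ[X][X]) {y z : S} (h : y ^ 2 = z) :
    (elimLetter 2 H).eval₂ η z = H.eval₂ η y * H.eval₂ η (-y) := by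
  change (conjProd H).eval₂ η z = _
  rw [← h, eval₂_conjProd]

theorem eval₂_elimLetter_three (H : ℤ[X][X]) {y z : S} (h : y ^ 2 = 1 - z) :
    (elimLetter 3 H).eval₂ η z = H.eval₂ η (1 - y) * H.eval₂ η (1 + y) := by
  change ((conjProd (H.comp (1 - X))).comp (1 - X)).eval₂ η z = _
  rw [eval₂_comp_eq, eval₂_sub, eval₂_one, eval₂_X, ← h, eval₂_conjProd, eval₂_comp_eq,
    eval₂_comp_eq, eval₂_sub, eval₂_sub, eval₂_one, eval₂_one, eval₂_X, eval₂_X,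
    sub_neg_eq_add]

/-- At each square root the selected sign contributes one of the two factors, and this factor
vanishes by induction. Only s(z)² = z matters, not how the branch is chosen. -/
theorem eval₂_elim_stringFunC {s : ℂ → ℂ} (hs : ∀ z, s z ^ 2 = z) (w : QString) (ξ ζ : ℂ)
    (h : stringFunC s w ζ = ξ) : (elim w).eval₂ (aeval ξ : ℤ[X] →ₐ[ℤ] ℂ).toRingHom ζ = 0 := by
  induction w generalizing ζ with
  | nil =>
    have h' : ζ = ξ := h
    simp [elim, h']
  | cons c w ih =>
    have := ih _ h
    rw [elim]
    fin_cases c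
    · exact (eval₂_elimLetter_zero _ _ _).trans this
    · exact (eval₂_elimLetter_one _ _ _).trans this
    · exact (eval₂_elimLetter_two _ _ (hs ζ)).trans (mul_eq_zero_of_left this _)
    · exact (eval₂_elimLetter_three _ _ (hs (1 - ζ))).trans (mul_eq_zero_of_left this _)

/-- Constants have square roots in ℂ, so each elimination step splits into two evaluations at
constants. At the end every factor is a constant minus X + a, and ℂ[X] has no zero divisors. The
shift a is 0 for `conjugatePoly` and r for the sign test. -/
theorem eval₂_elim_ne_zero {η : ℤ[X] →+* ℂ[X]} {a : ℂ} (hη : η X = X + C a) (w : QString) (ζ : ℂ) :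
    (elim w).eval₂ η (C ζ) ≠ 0 := by
  induction w generalizing ζ with
  | nil =>
    intro h
    have h1 : C ζ - (X + C a) = 0 := by simpa [elim, hη] using h
    have := congrArg (fun p => coeff p 1) h1
    simp at this
  | cons c w ih =>
    rw [elim]
    fin_cases c
    · refine (eval₂_elimLetter_zero _ _ _).trans_ne ?_
      rw [← C_pow]
      exact ih (ζ ^ 2)
    · refine (eval₂_elimLetter_one _ _ _).trans_ne ?_
      rw [← C_1, ← C_sub, ← C_pow, ← C_sub]
      exact ih (1 - (1 - ζ) ^ 2)
    · obtain ⟨y, hy⟩ := IsAlgClosed.exists_pow_nat_eq ζ two_pos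
      refine (eval₂_elimLetter_two _ _ (y := C y) (by rw [← C_pow, hy])).trans_ne ?_
      refine mul_ne_zero (ih y) ?_
      simpa using ih (-y)
    · obtain ⟨y, hy⟩ := IsAlgClosed.exists_pow_nat_eq (1 - ζ) two_pos
      refine (eval₂_elimLetter_three _ _ (y := C y) (by rw [← C_pow, hy]; simp)).trans_ne ?_
      refine mul_ne_zero ?_ ?_
      · simpa using ih (1 - y)
      · simpa using ih (1 + y)

end Eval

/-! ### The functions `I_w` on the unit interval -/

theorem letterFun_mem_Icc (c : Fin 4) {x : ℝ} (hx : x ∈ Set.Icc (0 : ℝ) 1) :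
    letterFun c x ∈ Set.Icc (0 : ℝ) 1 := by
  obtain ⟨h0, h1⟩ := hx
  fin_cases c
  · exact ⟨sq_nonneg x, pow_le_one₀ h0 h1⟩
  · exact ⟨show 0 ≤ 1 - (1 - x) ^ 2 by nlinarith, show 1 - (1 - x) ^ 2 ≤ 1 by nlinarith⟩
  · exact ⟨Real.sqrt_nonneg x, Real.sqrt_le_one.2 h1⟩
  · exact ⟨sub_nonneg.2 (Real.sqrt_le_one.2 (by linarith)),
      sub_le_self _ (Real.sqrt_nonneg _)⟩

theorem stringFun_mem_Icc (w : QString) {x : ℝ} (hx : x ∈ Set.Icc (0 : ℝ) 1) :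
    stringFun w x ∈ Set.Icc (0 : ℝ) 1 := by
  induction w generalizing x with
  | nil => exact hx
  | cons c w ih => exact ih (letterFun_mem_Icc c hx)

/-- The real analogue of `eval₂_elim_stringFunC`. It needs the unit interval, since `Real.sqrt` is a
genuine square root only of nonnegative numbers. -/
theorem eval₂_elim_stringFun (w : QString) {x : ℝ} (hx : x ∈ Set.Icc (0 : ℝ) 1)
    {η : ℤ[X] →+* ℝ} (hη : η X = stringFun w x) : (elim w).eval₂ η x = 0 := by
  induction w generalizing x with
  | nil =>
    have h : η X = x := hη
    simp [elim, h]
  | cons c w ih =>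
    have := ih (letterFun_mem_Icc c hx) hη
    rw [elim]
    fin_cases c
    · exact (eval₂_elimLetter_zero _ _ _).trans this
    · exact (eval₂_elimLetter_one _ _ _).trans this
    · exact (eval₂_elimLetter_two _ _ (Real.sq_sqrt hx.1)).trans (mul_eq_zero_of_left this _)
    · exact (eval₂_elimLetter_three _ _ (Real.sq_sqrt (sub_nonneg.2 hx.2))).trans
        (mul_eq_zero_of_left this _)

theorem continuous_letterFun (c : Fin 4) : Continuous (letterFun c) := by
  fin_cases c
  · exact continuous_pow 2
  · exact continuous_const.sub ((continuous_const.sub continuous_id).pow 2)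
  · exact Real.continuous_sqrt
  · exact continuous_const.sub (Real.continuous_sqrt.comp (continuous_const.sub continuous_id))

theorem continuous_stringFun (w : QString) : Continuous (stringFun w) := by
  induction w with
  | nil => exact continuous_id
  | cons c w ih => exact ih.comp (continuous_letterFun c)

theorem strictMonoOn_letterFun (c : Fin 4) : StrictMonoOn (letterFun c) (Set.Icc 0 1) := by
  intro x hx y hy h
  obtain ⟨h0, h1⟩ := hx
  obtain ⟨h2, h3⟩ := hy
  fin_cases c
  · exact show x ^ 2 < y ^ 2 by nlinarith
  · exact show 1 - (1 - x) ^ 2 < 1 - (1 - y) ^ 2 by nlinarith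
  · exact Real.sqrt_lt_sqrt h0 h
  · exact sub_lt_sub_left (Real.sqrt_lt_sqrt (by linarith) (by linarith)) 1

theorem strictMonoOn_stringFun (w : QString) : StrictMonoOn (stringFun w) (Set.Icc 0 1) := by
  induction w with
  | nil => exact strictMonoOn_id
  | cons c w ih => exact ih.comp (strictMonoOn_letterFun c) fun x hx => letterFun_mem_Icc c hx

theorem letterFun_zero (c : Fin 4) : letterFun c 0 = 0 := by
  fin_cases c <;> simp [letterFun]

theorem letterFun_one (c : Fin 4) : letterFun c 1 = 1 := by
  fin_cases c <;> simp [letterFun]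

theorem stringFun_zero (w : QString) : stringFun w 0 = 0 := by
  induction w with
  | nil => rfl
  | cons c w ih => rw [stringFun, letterFun_zero, ih]

theorem stringFun_one (w : QString) : stringFun w 1 = 1 := by
  induction w with
  | nil => rfl
  | cons c w ih => rw [stringFun, letterFun_one, ih]

theorem letterFun_letterInv (c : Fin 4) {x : ℝ} (hx : x ∈ Set.Icc (0 : ℝ) 1) :
    letterFun (letterInv c) (letterFun c x) = x := by
  obtain ⟨h0, h1⟩ := hx
  fin_cases c
  · exact Real.sqrt_sq h0
  · change 1 - Real.sqrt (1 - (1 - (1 - x) ^ 2)) = x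
    rw [sub_sub_cancel, Real.sqrt_sq (by linarith), sub_sub_cancel]
  · exact Real.sq_sqrt h0
  · change 1 - (1 - (1 - Real.sqrt (1 - x))) ^ 2 = x
    rw [sub_sub_cancel, Real.sq_sqrt (by linarith), sub_sub_cancel]

theorem stringFun_append (v w : QString) (x : ℝ) :
    stringFun (v ++ w) x = stringFun w (stringFun v x) := by
  induction v generalizing x with
  | nil => rfl
  | cons c v ih => exact ih _

theorem stringFun_mulInv (p q : QString) (x : ℝ) :
    stringFun (mulInv p q) x = stringFun (mulInv [] q) (stringFun p x) :=
  stringFun_append _ _ _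

theorem stringFun_mulInv_nil (q : QString) {x : ℝ} (hx : x ∈ Set.Icc (0 : ℝ) 1) :
    stringFun (mulInv [] q) (stringFun q x) = x := by
  induction q generalizing x with
  | nil => rfl
  | cons c q ih =>
    have : mulInv [] (c :: q) = mulInv [] q ++ [letterInv c] := by simp [mulInv]
    rw [this, stringFun_append, stringFun]
    exact (congrArg _ (ih (letterFun_mem_Icc c hx))).trans <| letterFun_letterInv c hx

theorem stringFun_mulInv_le_iff (p q : QString) {x : ℝ} (hx : x ∈ Set.Icc (0 : ℝ) 1) :
    x ≤ stringFun (mulInv p q) x ↔ stringFun q x ≤ stringFun p x := by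
  rw [stringFun_mulInv]
  conv_lhs => rw [← stringFun_mulInv_nil q hx]
  rw [stringFun_mulInv_nil q hx, ← (strictMonoOn_stringFun (mulInv [] q)).le_iff_le
    (stringFun_mem_Icc q hx) (stringFun_mem_Icc p hx), stringFun_mulInv_nil q hx]

theorem letterFun_mem_Ioo (c : Fin 4) {x : ℝ} (hx : x ∈ Set.Ioo (0 : ℝ) 1) :
    letterFun c x ∈ Set.Ioo (0 : ℝ) 1 := by
  have h := strictMonoOn_letterFun c
  have hx' := Set.Ioo_subset_Icc_self hx
  constructor
  · rw [← letterFun_zero c]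
    exact h (by simp) hx' hx.1
  · rw [← letterFun_one c]
    exact h hx' (by simp) hx.2

/-- The square roots fail to be analytic only at an end of the interval, and letters keep (0, 1)
inside itself. -/
theorem analyticAt_letterFun (c : Fin 4) {x : ℝ} (hx : x ∈ Set.Ioo (0 : ℝ) 1) :
    AnalyticAt ℝ (letterFun c) x := by
  have hs : ∀ y : ℝ, 0 < y → AnalyticAt ℝ Real.sqrt y := fun y hy =>
    (Real.contDiffAt_sqrt hy.ne').analyticAt
  fin_cases c
  · exact analyticAt_id.pow 2
  · exact analyticAt_const.sub ((analyticAt_const.sub analyticAt_id).pow 2)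
  · exact hs x hx.1
  · exact analyticAt_const.sub
      (AnalyticAt.fun_comp (f := fun y : ℝ => 1 - y) (hs (1 - x) (sub_pos.2 hx.2))
        (analyticAt_const.sub analyticAt_id))

theorem analyticAt_stringFun (w : QString) {x : ℝ} (hx : x ∈ Set.Ioo (0 : ℝ) 1) :
    AnalyticAt ℝ (stringFun w) x := by
  induction w generalizing x with
  | nil => exact analyticAt_id
  | cons c w ih =>
    exact (ih (letterFun_mem_Ioo c hx)).fun_comp (analyticAt_letterFun c hx)

/-- This is the identity theorem on the connected set (0, 1); the ends are fixed points of every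
I_w. -/
theorem stringFun_eq_of_eventuallyEq {w : QString} {ξ : ℝ} (hξ : ξ ∈ Set.Ioo (0 : ℝ) 1)
    (h : ∀ᶠ x in nhds ξ, stringFun w x - x = 0) :
    ∀ x ∈ Set.Icc (0 : ℝ) 1, stringFun w x - x = 0 := by
  have han : AnalyticOnNhd ℝ (fun x => stringFun w x - x) (Set.Ioo 0 1) := fun x hx =>
    (analyticAt_stringFun w hx).sub analyticAt_id
  have h0 := han.eqOn_zero_of_preconnected_of_eventuallyEq_zero isPreconnected_Ioo hξ h
  intro x hx
  rcases eq_or_lt_of_le hx.1 with rfl | hx0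
  · rw [stringFun_zero, sub_zero]
  rcases eq_or_lt_of_le hx.2 with rfl | hx1
  · rw [stringFun_one, sub_self]
  exact h0 ⟨hx0, hx1⟩

/-- Unless `I_w(x) - x` vanishes identically on `[0, 1]`, each point of `[0, 1]` is a limit of
points of `(0, 1)` where it does not vanish. -/
theorem mem_closure_stringFun_ne {w : QString}
    (h : ∃ x ∈ Set.Icc (0 : ℝ) 1, stringFun w x - x ≠ 0) {ξ : ℝ} (hξ : ξ ∈ Set.Icc (0 : ℝ) 1) :
    ξ ∈ closure {x ∈ Set.Ioo (0 : ℝ) 1 | stringFun w x - x ≠ 0} := by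
  rw [mem_closure_iff]
  intro U hU hξU
  by_contra hne
  -- If ξ is an end of the interval, analyticity is not available there, so an interior point of U
  -- is used instead.
  rw [← closure_Ioo zero_ne_one] at hξ
  obtain ⟨ζ, hζU, hζ⟩ := mem_closure_iff.1 hξ U hU hξU
  obtain ⟨x, hx, hx0⟩ := h
  refine hx0 (stringFun_eq_of_eventuallyEq hζ ?_ x hx)
  filter_upwards [hU.mem_nhds hζU, isOpen_Ioo.mem_nhds hζ] with y hyU hy
  by_contra hy0
  exact hne ⟨y, hyU, hy, hy0⟩

/-! ### The polynomial `f` -/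

theorem aeval_conjugateProduct {s : ℂ → ℂ} (hs : ∀ z, s z ^ 2 = z) (w : QString) (ξ : ℂ)
    (h : stringFunC s w ξ - ξ = 0) : aeval ξ (conjugateProduct w) = 0 := by
  have h1 := eval₂_elim_stringFunC hs w ξ ξ (sub_eq_zero.1 h)
  change (aeval ξ : ℤ[X] →ₐ[ℤ] ℂ).toRingHom ((elim w).eval₂ (RingHom.id _) X) = 0
  rw [hom_eval₂]
  simpa using h1

theorem conjugatePoly_ne_zero (w : QString) : conjugatePoly w ≠ 0 := by
  intro h
  -- Specialization at x = 0, with T as the remaining variable.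
  let ψ : ℤ[X][X] →+* ℂ[X] := eval₂RingHom (aeval (0 : ℂ[X]) : ℤ[X] →ₐ[ℤ] ℂ[X]).toRingHom X
  have h1 := congrArg ψ h
  rw [conjugatePoly, hom_eval₂, map_zero] at h1
  have h2 : ψ (C X) = C 0 := by simp [ψ]
  rw [h2] at h1
  exact eval₂_elim_ne_zero (a := 0) (by simp [ψ]) w 0 h1

theorem rootPoly_ne_zero (w : QString) : rootPoly w ≠ 0 := by
  rw [rootPoly, Ne, trailingCoeff_eq_zero]
  exact conjugatePoly_ne_zero w

theorem coeff_zero_conjugatePoly (w : QString) :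
    (conjugatePoly w).coeff 0 = conjugateProduct w := by
  rw [coeff_zero_eq_eval_zero, conjugatePoly, ← coe_evalRingHom, hom_eval₂, conjugateProduct, eval]
  congr 1
  · exact ringHom_ext (fun a => by simp) (by simp)
  · simp

theorem rootPoly_eq_conjugateProduct {w : QString} (h : conjugateProduct w ≠ 0) :
    rootPoly w = conjugateProduct w := by
  rw [← coeff_zero_conjugatePoly] at h ⊢
  rw [rootPoly, trailingCoeff, natTrailingDegree_eq_zero.2 (Or.inr h)]

/-- For T = φ(x) the substituted x + T is I_w(x), which annihilates the elimination polynomial at x.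
-/
theorem eval_conjugatePoly (w : QString) {x : ℝ} (hx : x ∈ Set.Icc (0 : ℝ) 1) :
    (conjugatePoly w).eval₂ (aeval x : ℤ[X] →ₐ[ℤ] ℝ).toRingHom (stringFun w x - x) = 0 := by
  rw [← coe_eval₂RingHom, conjugatePoly, hom_eval₂]
  have := eval₂_elim_stringFun w hx (η := (eval₂RingHom (aeval x : ℤ[X] →ₐ[ℤ] ℝ).toRingHom
    (stringFun w x - x)).comp (aeval (C X + X : ℤ[X][X]) : ℤ[X] →ₐ[ℤ] ℤ[X][X]).toRingHom)
    (by simp)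
  simpa using this

theorem aeval_rootPoly {w : QString} (h : ∃ x ∈ Set.Icc (0 : ℝ) 1, stringFun w x - x ≠ 0)
    {ξ : ℝ} (hξ : ξ ∈ Set.Icc (0 : ℝ) 1) (h0 : stringFun w ξ - ξ = 0) :
    aeval ξ (rootPoly w) = 0 := by
  -- Divide by the exact power of T; the constant coefficient of the quotient g in T is f.
  obtain ⟨g, hg⟩ := X_pow_dvd_iff.2 fun d (hd : d < (conjugatePoly w).natTrailingDegree) =>
    coeff_eq_zero_of_lt_natTrailingDegree hd
  have hg0 : rootPoly w = g.coeff 0 := by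
    rw [rootPoly, trailingCoeff]
    refine Eq.trans ?_ (coeff_X_pow_mul g (conjugatePoly w).natTrailingDegree 0)
    rw [← hg, zero_add]
  let G : ℝ → ℝ := fun x => g.eval₂ (aeval x : ℤ[X] →ₐ[ℤ] ℝ).toRingHom (stringFun w x - x)
  have hG : Continuous G := by
    simp only [G, eval₂_eq_sum_range]
    exact continuous_finsetSum _ fun i _ => (Polynomial.continuous_aeval (g.coeff i)).mul
      (((continuous_stringFun w).sub continuous_id).pow i)
  -- Where φ(x) ≠ 0, the factor φ(x)^m can be cancelled. The zero set of G is closed, so G also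
  -- vanishes at the root ξ, where G(ξ) = f(ξ).
  have hsub : {x ∈ Set.Ioo (0 : ℝ) 1 | stringFun w x - x ≠ 0} ⊆ G ⁻¹' {0} := by
    rintro x ⟨hx, hx0⟩
    have h1 := eval_conjugatePoly w (Set.Ioo_subset_Icc_self hx)
    rw [hg, eval₂_mul, eval₂_pow, eval₂_X] at h1
    exact (mul_eq_zero.1 h1).resolve_left (pow_ne_zero _ hx0)
  have h1 : G ξ = 0 :=
    closure_minimal hsub (isClosed_singleton.preimage hG) (mem_closure_stringFun_ne h hξ)
  rw [hg0]
  simpa [G, h0, eval₂_at_zero] using h1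

/-! ### Correctness of the procedure -/

theorem Frac.inUnit_iff (r : Frac) : r.inUnit = true ↔ r.toReal ∈ Set.Icc (0 : ℝ) 1 := by
  have h : (0 : ℝ) < (r.2 : ℝ) + 1 := by positivity
  rw [Frac.inUnit, Bool.and_eq_true, decide_eq_true_iff, decide_eq_true_iff, Set.mem_Icc,
    Frac.toReal, le_div_iff₀ h, div_le_iff₀ h, zero_mul, one_mul, Int.cast_nonneg_iff]
  norm_cast

theorem Frac.primrec_inUnit : Primrec Frac.inUnit :=
  Primrec.and.comp
    (primrecPred_iff_primrec_decide.1 (PrimrecRel.comp Primrec.int_le (.const 0) Primrec.fst))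
    (primrecPred_iff_primrec_decide.1 (PrimrecRel.comp Primrec.int_le Primrec.fst
      (Primrec.int_add.comp (Primrec.int_ofNat.comp Primrec.snd) (.const 1))))

theorem procedure_eq_true_iff_endpoints {iso : List ℤ → List (Frac × Frac)}
    {sgn : QString → Frac → Bool} (hsgn : IsSignTest sgn) (p q : QString) :
    procedure iso sgn p q = true ↔ ∀ J ∈ iso (rootPoly (mulInv p q)).coeffList,
      ∀ r, (r = J.1 ∨ r = J.2) → r.toReal ∈ Set.Icc (0 : ℝ) 1 →
        r.toReal ≤ stringFun (mulInv p q) r.toReal := by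
  have key : ∀ r : Frac, (!r.inUnit || sgn (mulInv p q) r) = true ↔
      (r.toReal ∈ Set.Icc (0 : ℝ) 1 → r.toReal ≤ stringFun (mulInv p q) r.toReal) := by
    intro r
    by_cases hr : r.toReal ∈ Set.Icc (0 : ℝ) 1
    · simp [(Frac.inUnit_iff r).2 hr, hsgn.2 _ r hr, hr]
    · have h : r.inUnit = false := by
        rw [← Bool.not_eq_true, Frac.inUnit_iff]
        exact hr
      simp [h, hr]
  simp only [procedure, List.all_eq_true, List.mem_flatMap, key]
  constructor
  · intro h J hJ r hr
    exact h r ⟨J, hJ, by simpa using hr⟩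
  · rintro h r ⟨J, hJ, hr⟩
    exact h J hJ r (by simpa using hr)

/-- If `φ` is negative at some point and `g` vanishes at the roots of `φ`, then `φ` is negative at
some right endpoint of an interval in an isolation of the roots of `g`. -/
theorem IsIsolation.exists_neg {g : ℤ[X]} {l : List (Frac × Frac)} (hl : IsIsolation g l)
    {φ : ℝ → ℝ} (hφ : Continuous φ) (h0 : φ 0 = 0) (h1 : φ 1 = 0)
    (hg : ∀ ξ ∈ Set.Icc (0 : ℝ) 1, φ ξ = 0 → aeval ξ g = 0) {x : ℝ}
    (hx : x ∈ Set.Icc (0 : ℝ) 1) (hneg : φ x < 0) :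
    ∃ J ∈ l, J.2.toReal ∈ Set.Icc (0 : ℝ) 1 ∧ φ J.2.toReal < 0 := by
  -- The zeros a and b of φ nearest to x on either side; they exist by compactness, as φ vanishes at
  -- 0 and 1.
  obtain ⟨a, ⟨⟨ha0, hax⟩, haφ⟩, ha⟩ : ∃ a, IsGreatest (Set.Icc 0 x ∩ φ ⁻¹' {0}) a :=
    (isCompact_Icc.inter_right (isClosed_singleton.preimage hφ)).exists_isGreatest
      ⟨0, ⟨le_refl 0, hx.1⟩, h0⟩
  obtain ⟨b, ⟨⟨hxb, hb1⟩, hbφ⟩, hb⟩ : ∃ b, IsLeast (Set.Icc x 1 ∩ φ ⁻¹' {0}) b :=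
    (isCompact_Icc.inter_right (isClosed_singleton.preimage hφ)).exists_isLeast
      ⟨1, ⟨hx.2, le_refl 1⟩, h1⟩
  have haφ : φ a = 0 := haφ
  have hbφ : φ b = 0 := hbφ
  have hax' : a < x := hax.lt_of_ne fun h => by rw [← h, haφ] at hneg; exact lt_irrefl _ hneg
  have hxb' : x < b := hxb.lt_of_ne fun h => by rw [h, hbφ] at hneg; exact lt_irrefl _ hneg
  have haI : a ∈ Set.Icc (0 : ℝ) 1 := ⟨ha0, by linarith⟩
  have hbI : b ∈ Set.Icc (0 : ℝ) 1 := ⟨by linarith, hb1⟩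
  have hab : ∀ y ∈ Set.Ioo a b, φ y < 0 := by
    intro y hy
    by_contra hy0
    rw [not_lt] at hy0
    rcases le_total y x with hyx | hyx
    · obtain ⟨z, hz, hz0⟩ := intermediate_value_Icc' hyx hφ.continuousOn ⟨hneg.le, hy0⟩
      have := ha ⟨⟨by linarith [hz.1, hy.1], hz.2⟩, hz0⟩
      linarith [hz.1, hy.1]
    · obtain ⟨z, hz, hz0⟩ := intermediate_value_Icc hyx hφ.continuousOn ⟨hneg.le, hy0⟩
      have := hb ⟨⟨hz.1, by linarith [hz.2, hy.2]⟩, hz0⟩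
      linarith [hz.2, hy.2]
  have hag := hg a haI haφ
  have hbg := hg b hbI hbφ
  obtain ⟨J, hJ, haJ⟩ := hl.cover a haI hag
  obtain ⟨K, hK, hbK⟩ := hl.cover b hbI hbg
  -- One interval cannot hold both roots a < b, and the list order cannot put the interval of b
  -- before that of a.
  have hle : J.2.toReal ≤ K.1.toReal := by
    by_cases hJK : J = K
    · subst hJK
      obtain ⟨ξ, -, hξ⟩ := hl.root J hJ
      have e1 : a = ξ := hξ.subset ⟨haJ, hag⟩
      have e2 : b = ξ := hξ.subset ⟨hbK, hbg⟩
      linarith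
    obtain ⟨i, hi, rfl⟩ := List.getElem_of_mem hJ
    obtain ⟨j, hj, rfl⟩ := List.getElem_of_mem hK
    have hd := List.pairwise_iff_getElem.1 hl.disjoint
    rcases lt_trichotomy i j with h | h | h
    · exact hd i j hi hj h
    · subst h
      exact absurd rfl hJK
    · have := hd j i hj hi h
      linarith [haJ.1, hbK.2]
  exact ⟨J, hJ, ⟨by linarith [haJ.2], by linarith [hbK.1]⟩, hab _ ⟨haJ.2, by linarith [hbK.1]⟩⟩

theorem procedure_eq_true_iff {iso : List ℤ → List (Frac × Frac)}
    {sgn : QString → Frac → Bool} (hiso : IsRootIsolator iso) (hsgn : IsSignTest sgn)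
    (p q : QString) : procedure iso sgn p q = true ↔
      ∀ x ∈ Set.Icc (0 : ℝ) 1, stringFun p x ≥ stringFun q x := by
  rw [procedure_eq_true_iff_endpoints hsgn]
  constructor
  · intro h x hx
    rw [ge_iff_le, ← stringFun_mulInv_le_iff p q hx]
    by_contra hlt
    rw [not_le, ← sub_neg] at hlt
    -- The point x with φ(x) < 0 also shows that φ is not identically zero, as needed for f to
    -- vanish at the roots of φ.
    obtain ⟨J, hJ, hJ1, hJ2⟩ := (hiso.2 _ (rootPoly_ne_zero (mulInv p q))).exists_neg
      ((continuous_stringFun (mulInv p q)).sub continuous_id)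
      (by simp [stringFun_zero]) (by simp [stringFun_one])
      (fun ξ hξ h0 => aeval_rootPoly ⟨x, hx, hlt.ne⟩ hξ h0) hx hlt
    have := h J hJ J.2 (Or.inr rfl) hJ1
    have hJ2 : stringFun (mulInv p q) J.2.toReal - J.2.toReal < 0 := hJ2
    linarith
  · intro h J _ r _ hr
    exact (stringFun_mulInv_le_iff p q hr).2 (h _ hr)

/-! ### Computation of the polynomial `f` -/

namespace RingCode

section TwoVariables

variable {B S γ : Type*} [Primcodable B] [Primcodable γ] [CommRing S] (d : RingCode B S)

/-- Evaluation of a polynomial in two variables, the inner variable at `a` and the outer variable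
at `b`; `h` gives the codes of the integers. -/
def evalTwo (h : ℤ → B) (a b : B) (E : List (List ℤ)) : B := d.horner (d.horner h a) b E

theorem dec_evalTwo {h : ℤ → B} (hh : ∀ z, d.dec (h z) = (z : S)) (a b : B)
    (E : List (List ℤ)) : d.dec (d.evalTwo h a b E) =
      (int.poly.polyDec E).eval₂ (aeval (d.dec a) : ℤ[X] →ₐ[ℤ] S).toRingHom (d.dec b) :=
  d.dec_horner (d := int.poly) (fun l => d.dec_horner (d := int) (η := algebraMap ℤ S)
    (fun z => by simp [hh]) a l) b E

theorem primrec_evalTwo {h : ℤ → B} (hh : Primrec h) {a b : γ → B} {E : γ → List (List ℤ)}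
    (ha : Primrec a) (hb : Primrec b) (hE : Primrec E) :
    Primrec fun g => d.evalTwo h (a g) (b g) (E g) :=
  d.primrec_horner (d.primrec_horner (hh.comp Primrec.snd).to₂ (ha.comp Primrec.fst)
    Primrec.snd).to₂ hb hE

end TwoVariables

/-- The operation `conjProd` on coefficient lists. -/
noncomputable def conjCode (H : List (List ℤ)) : List (List ℤ) :=
  int.poly.contractCode (int.poly.polyMul H (int.poly.compCode [[], [-1]] H))

theorem polyDec_conjCode (H : List (List ℤ)) :
    int.poly.polyDec (conjCode H) = conjProd (int.poly.polyDec H) := by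
  have h : int.poly.polyDec [[], [-1]] = -X := by simp [poly_dec]
  rw [conjCode, polyDec_contractCode, polyDec_polyMul, polyDec_compCode, h, conjProd]

theorem primrec_conjCode : Primrec conjCode :=
  int.poly.primrec_contractCode.comp (int.poly.primrec_polyMul.comp Primrec.id
    (int.poly.primrec_compCode.comp (.const _) Primrec.id))

/-- The operation `elimLetter` on coefficient lists. -/
noncomputable def elimLetterCode (c : Fin 4) (H : List (List ℤ)) : List (List ℤ) :=
  if c = 0 then int.poly.compCode [[], [], [1]] H
  -- The inserted polynomial is 2y - y² = 1 - (1 - y)².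
  else if c = 1 then int.poly.compCode [[], [2], [-1]] H
  else if c = 2 then conjCode H
  else int.poly.compCode [[1], [-1]] (conjCode (int.poly.compCode [[1], [-1]] H))

theorem polyDec_elimLetterCode (c : Fin 4) (H : List (List ℤ)) :
    int.poly.polyDec (elimLetterCode c H) = elimLetter c (int.poly.polyDec H) := by
  have h0 : int.poly.polyDec [[], [], [1]] = X ^ 2 := by
    simp [poly_dec]
    ring
  have h1 : int.poly.polyDec [[], [2], [-1]] = 1 - (1 - X) ^ 2 := by
    simp [poly_dec, map_ofNat C 2]
    ring
  have h3 : int.poly.polyDec [[1], [-1]] = 1 - X := by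
    simp [poly_dec]
    ring
  fin_cases c
  · exact (polyDec_compCode _ _ _).trans (by rw [h0]; rfl)
  · exact (polyDec_compCode _ _ _).trans (by rw [h1]; rfl)
  · exact polyDec_conjCode H
  · refine (polyDec_compCode _ _ _).trans ?_
    rw [polyDec_conjCode, polyDec_compCode, h3]
    rfl

theorem primrec_elimLetterCode : Primrec₂ elimLetterCode := by
  have heq : ∀ i : Fin 4, PrimrecPred fun p : Fin 4 × List (List ℤ) => p.1 = i := fun i =>
    PrimrecRel.comp Primrec.eq Primrec.fst (.const i)
  refine Primrec.ite (heq 0) ?_ (Primrec.ite (heq 1) ?_ (Primrec.ite (heq 2) ?_ ?_))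
  · exact int.poly.primrec_compCode.comp (.const _) Primrec.snd
  · exact int.poly.primrec_compCode.comp (.const _) Primrec.snd
  · exact primrec_conjCode.comp Primrec.snd
  · exact int.poly.primrec_compCode.comp (.const _)
      (primrec_conjCode.comp (int.poly.primrec_compCode.comp (.const _) Primrec.snd))

/-- A code of `elim w`. -/
noncomputable def elimCode (w : QString) : List (List ℤ) := w.foldr elimLetterCode [[0, -1], [1]]

theorem polyDec_elimCode (w : QString) : int.poly.polyDec (elimCode w) = elim w := by
  induction w with
  | nil =>
    simp [elimCode, elim, poly_dec]
    ring
  | cons c w ih => exact (polyDec_elimLetterCode c _).trans (congrArg (elimLetter c) ih)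

theorem primrec_elimCode : Primrec elimCode :=
  Primrec.list_foldr Primrec.id (.const _)
    (primrec_elimLetterCode.comp (Primrec.fst.comp Primrec.snd)
      (Primrec.snd.comp Primrec.snd)).to₂

/-- A code of `rootPoly w`. -/
noncomputable def rootCode (w : QString) : List ℤ :=
  int.poly.trailingCode (int.poly.poly.evalTwo (fun z => [[z]]) [[0, 1], [1]] [[0, 1]] (elimCode w))

theorem polyDec_rootCode (w : QString) : int.polyDec (rootCode w) = rootPoly w := by
  have h1 : int.poly.poly.dec [[0, 1], [1]] = C X + X := by simp [poly_dec]
  have h2 : int.poly.poly.dec [[0, 1]] = C X := by simp [poly_dec]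
  refine (int.poly.dec_trailingCode _).trans ?_
  rw [← poly_dec, dec_evalTwo _ (fun z => by simp [poly_dec]), polyDec_elimCode, h1, h2]
  rfl

theorem primrec_rootCode : Primrec rootCode :=
  int.poly.primrec_trailingCode.comp (int.poly.poly.primrec_evalTwo
    (Primrec.list_cons.comp (Primrec.list_cons.comp Primrec.id (.const [])) (.const []))
    (.const _) (.const _) primrec_elimCode)

end RingCode

theorem primrec_mulInv : Primrec₂ mulInv :=
  Primrec.list_append.comp Primrec.fst (Primrec.list_map (Primrec.list_reverse.comp Primrec.snd)
    ((Primrec.dom_finite letterInv).comp Primrec.snd).to₂)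

theorem primrec_coeffList_rootPoly : Primrec fun w => (rootPoly w).coeffList := by
  have h := (Primrec.list_dropWhile (primrecPred_iff_primrec_decide.1 Primrec.int_eq_zero)).comp
    (Primrec.list_reverse.comp RingCode.primrec_rootCode)
  exact h.of_eq fun w => by rw [← RingCode.polyDec_rootCode, RingCode.coeffList_polyDec_int]

theorem computable_procedure {iso : List ℤ → List (Frac × Frac)} {sgn : QString → Frac → Bool}
    (hiso : Computable iso) (hsgn : Computable₂ sgn) :
    Computable fun pq : QString × QString => procedure iso sgn pq.1 pq.2 := by
  have hw : Computable fun pq : QString × QString => mulInv pq.1 pq.2 := primrec_mulInv.to_comp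
  have hflat : Primrec fun l : List (Frac × Frac) => l.flatMap fun J => [J.1, J.2] :=
    Primrec.list_flatMap Primrec.id (Primrec.list_cons.comp (Primrec.fst.comp Primrec.snd)
      (Primrec.list_cons.comp (Primrec.snd.comp Primrec.snd) (.const []))).to₂
  refine Computable.list_all
    (hflat.to_comp.comp (hiso.comp (primrec_coeffList_rootPoly.to_comp.comp hw))) ?_
  exact (Primrec.or.to_comp.comp
    (Primrec.not.to_comp.comp (Frac.primrec_inUnit.to_comp.comp Computable.snd))
    (hsgn.comp (hw.comp Computable.fst) Computable.snd)).to₂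

/-! ### Bounds for polynomials with rational coefficients -/

namespace RingCode

/-- A bound for the values of a polynomial on `[-2, 2]`, and also a Lipschitz constant. -/
def valueBound (l : List Frac) : ℕ := l.foldr (fun c k => c.1.natAbs + 3 * k) 0

theorem primrec_valueBound : Primrec valueBound :=
  Primrec.list_foldr Primrec.id (.const 0)
    (Primrec.nat_add.comp
      (Primrec.int_natAbs.comp (Primrec.fst.comp (Primrec.fst.comp Primrec.snd)))
      (Primrec.nat_mul.comp (.const 3) (Primrec.snd.comp Primrec.snd))).to₂

theorem valueBound_cons (c : Frac) (l : List Frac) :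
    (valueBound (c :: l) : ℝ) = (c.1.natAbs : ℝ) + 3 * valueBound l := by
  simp [valueBound]

theorem abs_toReal_le (c : Frac) : |c.toReal| ≤ (c.1.natAbs : ℝ) := by
  have h : (0 : ℝ) < (c.2 : ℝ) + 1 := by positivity
  rw [Frac.toReal, abs_div, abs_of_pos h, div_le_iff₀ h, Nat.cast_natAbs, Int.cast_abs]
  exact le_mul_of_one_le_right (abs_nonneg _) (by simp)

theorem abs_eval_le (l : List Frac) {x : ℝ} (hx : |x| ≤ 2) :
    |(frac.polyDec l).eval x| ≤ valueBound l := by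
  induction l with
  | nil => simp [valueBound]
  | cons c l ih =>
    rw [polyDec_cons, valueBound_cons, eval_add, eval_C, eval_mul, eval_X]
    refine (abs_add_le _ _).trans (add_le_add (abs_toReal_le c) ?_)
    rw [abs_mul]
    nlinarith [abs_nonneg x, abs_nonneg ((frac.polyDec l).eval x)]

/-- With xp - yq = (x - y)p + y(p - q) and |y| ≤ 2, the value bound of the tail enters once through
p and twice through p - q; hence the factor 3 in `valueBound`. -/
theorem abs_eval_sub_le (l : List Frac) {x y : ℝ} (hx : |x| ≤ 2) (hy : |y| ≤ 2) :
    |(frac.polyDec l).eval x - (frac.polyDec l).eval y| ≤ valueBound l * |x - y| := by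
  induction l with
  | nil => simp [valueBound]
  | cons c l ih =>
    rw [polyDec_cons, valueBound_cons]
    simp only [eval_add, eval_C, eval_mul, eval_X]
    set p := (frac.polyDec l).eval x with hp
    set q := (frac.polyDec l).eval y
    have h1 : frac.dec c + x * p - (frac.dec c + y * q) = (x - y) * p + y * (p - q) := by ring
    have h2 : |p| ≤ valueBound l := abs_eval_le l hx
    rw [h1]
    refine (abs_add_le _ _).trans ?_
    rw [abs_mul, abs_mul]
    have h3 : |x - y| * |p| ≤ |x - y| * valueBound l :=
      mul_le_mul_of_nonneg_left h2 (abs_nonneg _)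
    have h4 : |y| * |p - q| ≤ 2 * (valueBound l * |x - y|) :=
      mul_le_mul hy ih (abs_nonneg _) zero_le_two
    have h5 : 0 ≤ (c.1.natAbs : ℝ) * |x - y| := by positivity
    linarith

/-- The reciprocal of a lower bound for the absolute values of the nonzero roots. -/
def rootBound (l : List Frac) : ℕ :=
  (l.foldr (fun c k => (c.2 + 1) + k) 0) * (valueBound l + 1)

theorem primrec_rootBound : Primrec rootBound :=
  Primrec.nat_mul.comp
    (Primrec.list_foldr Primrec.id (.const 0)
      (Primrec.nat_add.comp
        (Primrec.succ.comp (Primrec.snd.comp (Primrec.fst.comp Primrec.snd)))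
        (Primrec.snd.comp Primrec.snd)).to₂)
    (Primrec.succ.comp primrec_valueBound)

theorem rootBound_le_cons (c : Frac) (l : List Frac) : rootBound l ≤ rootBound (c :: l) := by
  refine Nat.mul_le_mul (Nat.le_add_left _ _) (Nat.succ_le_succ ?_)
  exact le_trans (by omega) (Nat.le_add_left (3 * valueBound l) _)

theorem le_rootBound_cons (c : Frac) (l : List Frac) :
    (c.2 + 1) * (valueBound l + 1) ≤ rootBound (c :: l) := by
  refine Nat.mul_le_mul (Nat.le_add_right _ _) (Nat.succ_le_succ ?_)
  exact le_trans (by omega) (Nat.le_add_left (3 * valueBound l) _)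

/-- After cancelling powers of t, the constant coefficient c is nonzero and c = -t p(t). Here |c| is
at least the reciprocal of its denominator, while |c| ≤ |t| · `valueBound` if |t| < 1. Adding up all
denominators keeps the bound monotone when zero coefficients are dropped. -/
theorem one_le_rootBound_mul_abs {l : List Frac} (hl : frac.polyDec l ≠ 0) {t : ℝ} (ht : t ≠ 0)
    (h0 : (frac.polyDec l).eval t = 0) : 1 ≤ rootBound l * |t| := by
  induction l with
  | nil => simp at hl
  | cons c l ih =>
    rw [polyDec_cons] at hl h0
    rw [eval_add, eval_C, eval_mul, eval_X] at h0
    by_cases hc : frac.dec c = 0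
    · rw [hc, zero_add] at h0
      rw [hc, C_0, zero_add] at hl
      refine (ih (right_ne_zero_of_mul hl) ((mul_eq_zero.1 h0).resolve_left ht)).trans ?_
      exact mul_le_mul_of_nonneg_right (Nat.cast_le.2 (rootBound_le_cons c l)) (abs_nonneg _)
    · have hb : ((c.2 : ℝ) + 1) * (valueBound l + 1) ≤ rootBound (c :: l) := by
        exact_mod_cast le_rootBound_cons c l
      have hd : (1 : ℝ) ≤ (c.2 : ℝ) + 1 := by simp
      have hv : (0 : ℝ) ≤ valueBound l := Nat.cast_nonneg _
      refine le_trans ?_ (mul_le_mul_of_nonneg_right hb (abs_nonneg t))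
      rcases le_or_gt 1 |t| with h1 | h1
      · exact one_le_mul_of_one_le_of_one_le
          (one_le_mul_of_one_le_of_one_le hd (by linarith)) h1
      · have h2 : |frac.dec c| ≤ |t| * valueBound l := by
          rw [eq_neg_of_add_eq_zero_left h0, abs_neg, abs_mul]
          exact mul_le_mul_of_nonneg_left (abs_eval_le l (by linarith)) (abs_nonneg _)
        have h3 : 1 ≤ ((c.2 : ℝ) + 1) * |frac.dec c| := by
          have hpos : (0 : ℝ) < (c.2 : ℝ) + 1 := by positivity
          have hc1 : c.1 ≠ 0 := fun h => hc (by simp [frac_dec, Frac.toReal, h])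
          rw [frac_dec, Frac.toReal, abs_div, abs_of_pos hpos, mul_div_cancel₀ _ hpos.ne',
            ← Int.cast_abs]
          exact_mod_cast Int.one_le_abs hc1
        nlinarith [mul_nonneg (zero_le_one.trans hd) (abs_nonneg t),
          mul_le_mul_of_nonneg_left h2 (zero_le_one.trans hd)]

/-! ### The sign test -/

/-- A code of the polynomial in `T` whose roots are the conjugates of `I_w(r) - r`. -/
noncomputable def shiftedElimCode (w : QString) (r : Frac) : List Frac :=
  frac.poly.evalTwo (fun z => [(z, 0)]) [r, frac.one] [r] (elimCode w)

theorem polyDec_shiftedElimCode (w : QString) (r : Frac) :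
    frac.polyDec (shiftedElimCode w r) = (elim w).eval₂
      (aeval (C r.toReal + X) : ℤ[X] →ₐ[ℤ] ℝ[X]).toRingHom (C r.toReal) := by
  refine (dec_evalTwo frac.poly (fun z => ?_) _ _ _).trans ?_
  · simp [poly_dec, frac_dec, Frac.toReal]
  · have h1 : frac.poly.dec [r, frac.one] = C r.toReal + X := by
      simp [poly_dec, frac.dec_one, frac_dec]
    have h2 : frac.poly.dec [r] = C r.toReal := by simp [poly_dec, frac_dec]
    rw [polyDec_elimCode, h1, h2]
    congr 1

theorem primrec_shiftedElimCode : Primrec₂ shiftedElimCode :=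
  frac.poly.primrec_evalTwo
    (Primrec.list_cons.comp (Primrec.pair Primrec.id (.const 0)) (.const []))
    (Primrec.list_cons.comp Primrec.snd (.const _))
    (Primrec.list_cons.comp Primrec.snd (.const [])) (primrec_elimCode.comp Primrec.fst)

theorem shiftedElimCode_ne_zero (w : QString) (r : Frac) :
    frac.polyDec (shiftedElimCode w r) ≠ 0 := by
  rw [polyDec_shiftedElimCode]
  intro h
  have h1 := congrArg (mapRingHom (algebraMap ℝ ℂ)) h
  rw [hom_eval₂, map_zero, coe_mapRingHom, map_C] at h1
  exact eval₂_elim_ne_zero (a := (r.toReal : ℂ)) (by simp [add_comm]) w _ h1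

theorem eval_shiftedElimCode (w : QString) (r : Frac) (hr : r.toReal ∈ Set.Icc (0 : ℝ) 1) :
    (frac.polyDec (shiftedElimCode w r)).eval (stringFun w r.toReal - r.toReal) = 0 := by
  rw [polyDec_shiftedElimCode, ← coe_evalRingHom, hom_eval₂, coe_evalRingHom, eval_C]
  exact eval₂_elim_stringFun w hr (by simp)

end RingCode

/-! ### Certificates by rational lower bounds -/

section Chain

open RingCode

/-- The letter `0` on fractions. -/
noncomputable def fracSq (x : Frac) : Frac := frac.mul x x

/-- The letter `1` on fractions. -/
noncomputable def fracCoSq (x : Frac) : Frac :=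
  frac.add frac.one (frac.neg (fracSq (frac.add frac.one (frac.neg x))))

theorem toReal_fracSq (x : Frac) : (fracSq x).toReal = x.toReal ^ 2 :=
  (frac.dec_mul x x).trans (sq _).symm

theorem toReal_fracCoSq (x : Frac) : (fracCoSq x).toReal = 1 - (1 - x.toReal) ^ 2 := by
  rw [fracCoSq, ← frac_dec, frac.dec_add, frac.dec_neg, frac_dec (fracSq _), toReal_fracSq,
    ← frac_dec, frac.dec_add, frac.dec_neg, frac.dec_one, frac_dec]
  ring

theorem primrec_fracSq : Primrec fracSq := frac.primrec_mul.comp Primrec.id Primrec.id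

theorem primrec_fracCoSq : Primrec fracCoSq :=
  frac.primrec_add.comp (.const _) (frac.primrec_neg.comp (primrec_fracSq.comp
    (frac.primrec_add.comp (.const _) (frac.primrec_neg.comp Primrec.id))))

/-- Whether `a` is a lower bound of `I_c(x)` in `[0, 1]`. -/
noncomputable def lowerTest (c : Fin 4) (x a : Frac) : Bool :=
  a.inUnit && if c = 0 then fracLe a (fracSq x) else if c = 1 then fracLe a (fracCoSq x)
    else if c = 2 then fracLe (fracSq a) x else fracLe (fracCoSq a) x

/-- For the letters with a root, the inverse letter is applied to `a`, as in a ≤ √x ↔ a² ≤ x, so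
only rational arithmetic is needed. -/
theorem lowerTest_iff (c : Fin 4) {x : Frac} (hx : x.toReal ∈ Set.Icc (0 : ℝ) 1) (a : Frac) :
    lowerTest c x a = true ↔ a.toReal ∈ Set.Icc (0 : ℝ) 1 ∧ a.toReal ≤ letterFun c x.toReal := by
  rw [lowerTest, Bool.and_eq_true, Frac.inUnit_iff]
  refine and_congr_right fun ha => ?_
  fin_cases c
  · exact (fracLe_iff _ _).trans (by rw [toReal_fracSq]; rfl)
  · exact (fracLe_iff _ _).trans (by rw [toReal_fracCoSq]; rfl)
  · refine (fracLe_iff _ _).trans ?_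
    rw [toReal_fracSq]
    exact (Real.le_sqrt ha.1 hx.1).symm
  · refine (fracLe_iff _ _).trans ?_
    rw [toReal_fracCoSq]
    change _ ↔ a.toReal ≤ 1 - Real.sqrt (1 - x.toReal)
    rw [le_sub_comm, Real.sqrt_le_left (sub_nonneg.2 ha.2), sub_le_comm]

theorem primrec_lowerTest :
    Primrec fun t : Fin 4 × Frac × Frac => lowerTest t.1 t.2.1 t.2.2 := by
  have heq : ∀ i : Fin 4, PrimrecPred fun t : Fin 4 × Frac × Frac => t.1 = i := fun i =>
    PrimrecRel.comp Primrec.eq Primrec.fst (.const i)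
  have hx := Primrec.fst.comp (Primrec.snd (α := Fin 4) (β := Frac × Frac))
  have ha := Primrec.snd.comp (Primrec.snd (α := Fin 4) (β := Frac × Frac))
  exact Primrec.and.comp (Frac.primrec_inUnit.comp ha)
    (Primrec.ite (heq 0) (primrec_fracLe.comp ha (primrec_fracSq.comp hx))
      (Primrec.ite (heq 1) (primrec_fracLe.comp ha (primrec_fracCoSq.comp hx))
        (Primrec.ite (heq 2) (primrec_fracLe.comp (primrec_fracSq.comp ha) hx)
          (primrec_fracLe.comp (primrec_fracCoSq.comp ha) hx))))

/-- Run through a list of letters and lower bounds; check that each number is a lower bound of the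
letter at the preceding number, and return the last number. -/
noncomputable def chainRun (s : Bool × Frac) (W : List (Fin 4 × Frac)) : Bool × Frac :=
  W.foldl (fun s e => (s.1 && lowerTest e.1 s.2 e.2, e.2)) s

theorem primrec_chainRun : Primrec₂ chainRun :=
  Primrec.list_foldl Primrec.snd Primrec.fst
    (Primrec.pair
      (Primrec.and.comp (Primrec.fst.comp (Primrec.fst.comp Primrec.snd))
        (primrec_lowerTest.comp (Primrec.pair (Primrec.fst.comp (Primrec.snd.comp Primrec.snd))
          (Primrec.pair (Primrec.snd.comp (Primrec.fst.comp Primrec.snd))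
            (Primrec.snd.comp (Primrec.snd.comp Primrec.snd))))))
      (Primrec.snd.comp (Primrec.snd.comp Primrec.snd))).to₂

theorem chainRun_false (x : Frac) (W : List (Fin 4 × Frac)) :
    (chainRun (false, x) W).1 = false := by
  induction W generalizing x with
  | nil => rfl
  | cons e W ih => exact ih e.2

/-- Monotonicity of the remaining string carries each lower bound to the end. -/
theorem chainRun_sound {x : Frac} {W : List (Fin 4 × Frac)}
    (hx : x.toReal ∈ Set.Icc (0 : ℝ) 1) (h : (chainRun (true, x) W).1 = true) :
    (chainRun (true, x) W).2.toReal ≤ stringFun (W.map Prod.fst) x.toReal := by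
  induction W generalizing x with
  | nil => exact le_rfl
  | cons e W ih =>
    obtain ⟨c, a⟩ := e
    have hrun : chainRun (true, x) ((c, a) :: W) = chainRun (lowerTest c x a, a) W := rfl
    rw [hrun] at h ⊢
    cases ht : lowerTest c x a with
    | false =>
      rw [ht, chainRun_false] at h
      exact absurd h Bool.false_ne_true
    | true =>
      obtain ⟨ha, hle⟩ := (lowerTest_iff c hx a).1 ht
      rw [ht] at h
      exact (ih ha h).trans
        ((strictMonoOn_stringFun _).monotoneOn ha (letterFun_mem_Icc c hx) hle)

theorem exists_frac_toReal (q : ℚ) : ∃ r : Frac, r.toReal = q := by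
  refine ⟨(q.num, q.den - 1), ?_⟩
  rw [Frac.toReal, Nat.cast_sub q.den_pos, Nat.cast_one, sub_add_cancel]
  exact_mod_cast Rat.num_div_den q

theorem exists_chainRun (w : QString) {x : Frac} (hx : x.toReal ∈ Set.Icc (0 : ℝ) 1) {y : ℝ}
    (hy : y < stringFun w x.toReal) : ∃ W : List (Fin 4 × Frac), W.map Prod.fst = w ∧
      (chainRun (true, x) W).1 = true ∧ y < (chainRun (true, x) W).2.toReal := by
  induction w generalizing x with
  | nil => exact ⟨[], rfl, rfl, hy⟩
  | cons c w ih =>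
    set u := letterFun c x.toReal with hu
    have hu' : u ∈ Set.Icc (0 : ℝ) 1 := letterFun_mem_Icc c hx
    have hyu : y < stringFun w u := hy
    obtain ⟨a, ha, hau, hya⟩ : ∃ a : Frac, a.toReal ∈ Set.Icc (0 : ℝ) 1 ∧ a.toReal ≤ u ∧
        y < stringFun w a.toReal := by
      -- If u = 0, the only admissible bound is 0 itself. Otherwise, by continuity, a positive
      -- rational slightly below u still has an image above y.
      rcases eq_or_lt_of_le hu'.1 with h0 | h0
      · have hz : Frac.toReal (0, 0) = 0 := by simp [Frac.toReal]
        refine ⟨(0, 0), ?_, ?_, ?_⟩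
        · simp [hz]
        · rw [hz]
          exact hu'.1
        · rw [hz, h0]
          exact hyu
      · have hev := ((continuous_stringFun w).tendsto u).eventually_const_lt hyu
        obtain ⟨l, hl, hlu⟩ := (mem_nhdsLE_iff_exists_Ioc_subset' h0).1
          (nhdsWithin_le_nhds hev)
        obtain ⟨q, hq1, hq2⟩ := exists_rat_btwn (max_lt hl h0)
        obtain ⟨a, ha⟩ := exists_frac_toReal q
        rw [← ha] at hq1 hq2
        rw [max_lt_iff] at hq1
        exact ⟨a, ⟨hq1.2.le, hq2.le.trans hu'.2⟩, hq2.le, hlu ⟨hq1.1, hq2.le⟩⟩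
    obtain ⟨W, hW, hrun, hend⟩ := ih ha hya
    have ht : lowerTest c x a = true := (lowerTest_iff c hx a).2 ⟨ha, hau⟩
    have h : chainRun (true, x) ((c, a) :: W) = chainRun (true, a) W := by
      simp [chainRun, ht]
    exact ⟨(c, a) :: W, by simp [hW], by rw [h, hrun], by rwa [h]⟩

/-- Whether `W` is a list of lower bounds for the letters of `w`, starting at `r`, with last bound
larger than `s`. -/
noncomputable def chainTest (w : QString) (r s : Frac) (W : List (Fin 4 × Frac)) : Bool :=
  decide (W.map Prod.fst = w) && ((chainRun (true, r) W).1 && !fracLe (chainRun (true, r) W).2 s)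

theorem chainTest_iff (w : QString) (r s : Frac) (W : List (Fin 4 × Frac)) :
    chainTest w r s W = true ↔ W.map Prod.fst = w ∧ (chainRun (true, r) W).1 = true ∧
      s.toReal < (chainRun (true, r) W).2.toReal := by
  rw [chainTest, Bool.and_eq_true, Bool.and_eq_true, decide_eq_true_iff, Bool.not_eq_true',
    ← Bool.not_eq_true, fracLe_iff, not_le]

theorem exists_chainTest_iff (w : QString) {r : Frac} (hr : r.toReal ∈ Set.Icc (0 : ℝ) 1)
    (s : Frac) : (∃ W, chainTest w r s W = true) ↔ s.toReal < stringFun w r.toReal := by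
  simp only [chainTest_iff]
  constructor
  · rintro ⟨W, rfl, h, hs⟩
    exact hs.trans_le (chainRun_sound hr h)
  · exact exists_chainRun w hr

theorem primrec_chainTest {γ : Type*} [Primcodable γ] {w : γ → QString} {r s : γ → Frac}
    {W : γ → List (Fin 4 × Frac)} (hw : Primrec w) (hr : Primrec r) (hs : Primrec s)
    (hW : Primrec W) : Primrec fun g => chainTest (w g) (r g) (s g) (W g) := by
  have hrun := primrec_chainRun.comp (Primrec.pair (.const true) hr) hW
  refine Primrec.and.comp ?_ (Primrec.and.comp (Primrec.fst.comp hrun)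
    (Primrec.not.comp (primrec_fracLe.comp (Primrec.snd.comp hrun) hs)))
  exact primrecPred_iff_primrec_decide.1
    (PrimrecRel.comp Primrec.eq (Primrec.list_map hW (Primrec.fst.comp Primrec.snd).to₂) hw)

/-- A rational number slightly less than `r` such that `I_w(r)` is not between these numbers. -/
noncomputable def signThreshold (w : QString) (r : Frac) : Frac :=
  frac.add r (-1, rootBound (shiftedElimCode w r))

/-- A negative I_w(r) - r is a nonzero root of the shifted polynomial, so its absolute value is at
least 1/k for the root bound k, which exceeds the shift 1/(k + 1). This makes the non-strict
inequality accessible to approximation from below. -/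
theorem signThreshold_lt_iff (w : QString) {r : Frac} (hr : r.toReal ∈ Set.Icc (0 : ℝ) 1) :
    (signThreshold w r).toReal < stringFun w r.toReal ↔ r.toReal ≤ stringFun w r.toReal := by
  set k := rootBound (shiftedElimCode w r) with hk
  have hpos : (0 : ℝ) < (k : ℝ) + 1 := by positivity
  have h : (signThreshold w r).toReal = r.toReal - 1 / ((k : ℝ) + 1) := by
    rw [signThreshold, ← frac_dec, frac.dec_add, frac_dec, frac_dec]
    simp only [Frac.toReal, ← hk]
    push_cast
    ring
  rw [h]
  have hinv : 0 < 1 / ((k : ℝ) + 1) := by positivity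
  constructor
  · intro hlt
    by_contra hneg
    rw [not_le, ← sub_neg] at hneg
    have h1 := one_le_rootBound_mul_abs (shiftedElimCode_ne_zero w r) hneg.ne
      (eval_shiftedElimCode w r hr)
    rw [abs_of_neg hneg, ← hk] at h1
    have h2 : -(stringFun w r.toReal - r.toReal) < 1 / ((k : ℝ) + 1) := by linarith
    rw [lt_div_iff₀ hpos] at h2
    linarith
  · intro hle
    linarith

/-- The inverse string turns an upper estimate into a lower one, so that one kind of certificate
serves both answers. -/
theorem lt_stringFun_mulInv_nil_iff (w : QString) {x : ℝ} (hx : x ∈ Set.Icc (0 : ℝ) 1) :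
    x < stringFun (mulInv [] w) x ↔ stringFun w x < x := by
  have h := (strictMonoOn_stringFun (mulInv [] w)).lt_iff_lt (stringFun_mem_Icc w hx) hx
  rwa [stringFun_mulInv_nil w hx] at h

theorem exists_isSignTest : ∃ sgn, IsSignTest sgn := by
  -- The Boolean is the claimed answer and the list is its certificate. Fractions outside [0, 1]
  -- accept anything, to make the search total.
  let R : QString × Frac → Bool × List (Fin 4 × Frac) → Bool := fun a b =>
    !a.2.inUnit || bif b.1 then chainTest a.1 a.2 (signThreshold a.1 a.2) b.2
      else chainTest (mulInv [] a.1) a.2 a.2 b.2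
  have hR : Primrec₂ R := by
    have hw := Primrec.fst.comp
      (Primrec.fst (α := QString × Frac) (β := Bool × List (Fin 4 × Frac)))
    have hr := Primrec.snd.comp
      (Primrec.fst (α := QString × Frac) (β := Bool × List (Fin 4 × Frac)))
    have hb := Primrec.fst.comp
      (Primrec.snd (α := QString × Frac) (β := Bool × List (Fin 4 × Frac)))
    have hW := Primrec.snd.comp
      (Primrec.snd (α := QString × Frac) (β := Bool × List (Fin 4 × Frac)))
    refine Primrec.or.comp (Primrec.not.comp (Frac.primrec_inUnit.comp hr)) (Primrec.cond hb
      (primrec_chainTest hw hr ?_ hW)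
      (primrec_chainTest (primrec_mulInv.comp (.const []) hw) hr hr hW))
    exact frac.primrec_add.comp hr (Primrec.pair (.const _)
      (primrec_rootBound.comp (primrec_shiftedElimCode.comp hw hr)))
  obtain ⟨f, hf, hfR⟩ := exists_computable_of_test hR.to_comp (by
    rintro ⟨w, r⟩
    by_cases hr : r.toReal ∈ Set.Icc (0 : ℝ) 1
    · by_cases h : r.toReal ≤ stringFun w r.toReal
      · obtain ⟨W, hW⟩ := (exists_chainTest_iff w hr _).2 ((signThreshold_lt_iff w hr).2 h)
        exact ⟨(true, W), by simp [R, hW]⟩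
      · obtain ⟨W, hW⟩ := (exists_chainTest_iff (mulInv [] w) hr r).2
          ((lt_stringFun_mulInv_nil_iff w hr).2 (not_le.1 h))
        exact ⟨(false, W), by simp [R, hW]⟩
    · refine ⟨(true, []), ?_⟩
      have : r.inUnit = false := by
        rw [← Bool.not_eq_true, Frac.inUnit_iff]
        exact hr
      simp [R, this])
  refine ⟨fun w r => (f (w, r)).1, Computable.fst.comp hf, fun w r hr => ?_⟩
  have h := hfR (w, r)
  simp only [R, (Frac.inUnit_iff r).2 hr, Bool.not_true, Bool.false_or] at h
  rw [sub_nonneg]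
  cases hb : (f (w, r)).1 with
  | true =>
    rw [hb, cond_true] at h
    exact iff_of_true hb
      ((signThreshold_lt_iff w hr).1 ((exists_chainTest_iff w hr _).1 ⟨_, h⟩))
  | false =>
    rw [hb, cond_false] at h
    exact iff_of_false (by simp [hb]) (not_le.2 ((lt_stringFun_mulInv_nil_iff w hr).1
      ((exists_chainTest_iff (mulInv [] w) hr r).1 ⟨_, h⟩)))

end Chain

/-! ### Isolation of roots -/

section Grid

open RingCode

/-- The grid point `(2i - 1) / (2(k + 1))`. -/
def gridFrac (k i : ℕ) : Frac := ((2 * i : ℕ) - (1 : ℕ), 2 * k + 1)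

/-- The maximum of `0` and a grid point. -/
def gridLeft (k i : ℕ) : Frac := ((2 * i - 1 : ℕ), 2 * k + 1)

/-- The minimum of `1` and the grid point following a given grid point. -/
def gridRight (k i : ℕ) : Frac := ((min (2 * i + 1) (2 * k + 2) : ℕ), 2 * k + 1)

/-- The shift by half a mesh makes the cells with i < k + 2 reach beyond both ends of [0, 1], and
lets the grid points avoid rational roots by parity. -/
theorem toReal_gridFrac (k i : ℕ) :
    (gridFrac k i).toReal = ((i : ℝ) - 1 / 2) / ((k : ℝ) + 1) := by
  have h : (k : ℝ) + 1 ≠ 0 := by positivity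
  simp only [gridFrac, Frac.toReal]
  push_cast
  field_simp
  ring

theorem gridFrac_succ_sub (k i : ℕ) :
    (gridFrac k (i + 1)).toReal - (gridFrac k i).toReal = 1 / ((k : ℝ) + 1) := by
  rw [toReal_gridFrac, toReal_gridFrac, ← sub_div]
  push_cast
  ring

theorem gridFrac_mono (k : ℕ) : Monotone fun i => (gridFrac k i).toReal := by
  intro i j h
  simp only [toReal_gridFrac]
  have : (i : ℝ) ≤ j := Nat.cast_le.2 h
  gcongr

/-- Truncated subtraction in ℕ produces the maximum with 0: only the grid point with i = 0 is
negative. -/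
theorem toReal_gridLeft (k i : ℕ) : (gridLeft k i).toReal = max 0 (gridFrac k i).toReal := by
  have h : (0 : ℝ) < (k : ℝ) + 1 := by positivity
  rw [toReal_gridFrac]
  rcases Nat.eq_zero_or_pos i with rfl | hi
  · rw [max_eq_left (by
      rw [Nat.cast_zero]
      exact div_nonpos_of_nonpos_of_nonneg (by norm_num) h.le)]
    simp [gridLeft, Frac.toReal]
  · have h1 : (1 : ℝ) ≤ i := by exact_mod_cast hi
    rw [max_eq_right (div_nonneg (by linarith) h.le), gridLeft, Frac.toReal]
    have h2 : ((2 * i - 1 : ℕ) : ℝ) = 2 * i - 1 := by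
      rw [Nat.cast_sub (by omega)]
      push_cast
      ring
    push_cast [h2]
    field_simp
    ring

theorem toReal_gridRight (k i : ℕ) :
    (gridRight k i).toReal = min 1 (gridFrac k (i + 1)).toReal := by
  have h : (0 : ℝ) < (k : ℝ) + 1 := by positivity
  rw [toReal_gridFrac, gridRight, Frac.toReal, min_def, min_def]
  simp only [le_div_iff₀ h]
  push_cast
  by_cases hi : k + 1 ≤ i
  · have h1 : (k : ℝ) + 1 ≤ i := by exact_mod_cast hi
    rw [if_neg (by omega), if_pos (by linarith)]
    field_simp
    ring
  · have h1 : (i : ℝ) + 1 ≤ (k : ℝ) + 1 := by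
      have : i + 1 ≤ k + 1 := by omega
      exact_mod_cast this
    rw [if_pos (by omega), if_neg (by linarith)]
    field_simp
    ring

theorem abs_le_two_of_mem_grid {k i : ℕ} (hi : i < k + 2) {x : ℝ}
    (hx : x ∈ Set.Icc (gridFrac k i).toReal (gridFrac k (i + 1)).toReal) :
    x ∈ Set.Icc (-1 : ℝ) 2 := by
  have h : (0 : ℝ) < (k : ℝ) + 1 := by positivity
  have hi' : (i : ℝ) ≤ (k : ℝ) + 1 := by exact_mod_cast Nat.le_of_lt_succ hi
  have hi0 : (0 : ℝ) ≤ i := Nat.cast_nonneg i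
  have hk0 : (0 : ℝ) ≤ k := Nat.cast_nonneg k
  rw [toReal_gridFrac, toReal_gridFrac, Set.mem_Icc, div_le_iff₀ h, le_div_iff₀ h] at hx
  push_cast at hx
  constructor <;> nlinarith [hx.1, hx.2]

/-- Whether the absolute value of a fraction is larger than `V / (k + 1)`. -/
def largeTest (V k : ℕ) (r : Frac) : Bool := decide (V * (r.2 + 1) < r.1.natAbs * (k + 1))

theorem largeTest_iff (V k : ℕ) (r : Frac) :
    largeTest V k r = true ↔ (V : ℝ) * (1 / ((k : ℝ) + 1)) < |r.toReal| := by
  have h : (0 : ℝ) < (k : ℝ) + 1 := by positivity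
  have h' : (0 : ℝ) < (r.2 : ℝ) + 1 := by positivity
  rw [largeTest, decide_eq_true_iff, Frac.toReal, abs_div, abs_of_pos h', mul_one_div,
    div_lt_div_iff₀ h h', ← Int.cast_abs, ← Nat.cast_natAbs]
  norm_cast

/-- Whether each interval of the grid contains no root or is an interval on which the polynomial
is monotone, and no root is a grid point. -/
noncomputable def gridTest (l : List Frac) (k : ℕ) : Bool :=
  (List.range (k + 2)).all fun i =>
    (!frac.isZero (frac.evalCode (gridFrac k i) l) &&
      !frac.isZero (frac.evalCode (gridFrac k (i + 1)) l)) &&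
    (largeTest (valueBound l) k (frac.evalCode (gridFrac k i) l) ||
      largeTest (valueBound (frac.derivCode l)) k
        (frac.evalCode (gridFrac k i) (frac.derivCode l)))

/-- The intervals of the grid that contain a root in `[0, 1]`. -/
noncomputable def gridIntervals (l : List Frac) (k : ℕ) : List (Frac × Frac) :=
  ((List.range (k + 2)).filter fun i =>
    fracLe (frac.mul (frac.evalCode (gridLeft k i) l) (frac.evalCode (gridRight k i) l))
      frac.zero).map fun i => (gridFrac k i, gridFrac k (i + 1))

theorem gridTest_iff (l : List Frac) (k : ℕ) : gridTest l k = true ↔ ∀ i < k + 2,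
    ((frac.polyDec l).eval (gridFrac k i).toReal ≠ 0 ∧
      (frac.polyDec l).eval (gridFrac k (i + 1)).toReal ≠ 0) ∧
    ((valueBound l : ℝ) * (1 / ((k : ℝ) + 1)) < |(frac.polyDec l).eval (gridFrac k i).toReal| ∨
      (valueBound (frac.derivCode l) : ℝ) * (1 / ((k : ℝ) + 1)) <
        |(derivative (frac.polyDec l)).eval (gridFrac k i).toReal|) := by
  simp only [gridTest, List.all_eq_true, List.mem_range, Bool.and_eq_true, Bool.or_eq_true,
    Bool.not_eq_true', ← Bool.not_eq_true, frac.isZero_iff, largeTest_iff, ← frac_dec,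
    dec_evalCode, polyDec_derivCode]

theorem mem_gridIntervals (l : List Frac) (k : ℕ) (J : Frac × Frac) :
    J ∈ gridIntervals l k ↔ ∃ i < k + 2, (frac.polyDec l).eval (gridLeft k i).toReal *
      (frac.polyDec l).eval (gridRight k i).toReal ≤ 0 ∧
      (gridFrac k i, gridFrac k (i + 1)) = J := by
  simp only [gridIntervals, List.mem_map, List.mem_filter, List.mem_range, fracLe_iff, ← frac_dec,
    frac.dec_mul, dec_evalCode, frac.dec_zero, and_assoc]

/-- If a polynomial passes the test, then on each interval of the grid it has no root or is
strictly monotone. -/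
theorem gridTest_cases {l : List Frac} {k : ℕ} (h : gridTest l k = true) {i : ℕ} (hi : i < k + 2) :
    (∀ x ∈ Set.Icc (gridFrac k i).toReal (gridFrac k (i + 1)).toReal,
      (frac.polyDec l).eval x ≠ 0) ∨
    StrictMonoOn (fun x => (frac.polyDec l).eval x)
      (Set.Icc (gridFrac k i).toReal (gridFrac k (i + 1)).toReal) ∨
    StrictAntiOn (fun x => (frac.polyDec l).eval x)
      (Set.Icc (gridFrac k i).toReal (gridFrac k (i + 1)).toReal) := by
  set p := frac.polyDec l with hp
  set a := (gridFrac k i).toReal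
  set b := (gridFrac k (i + 1)).toReal
  have hab : b - a = 1 / ((k : ℝ) + 1) := gridFrac_succ_sub k i
  have hab' : a ≤ b := gridFrac_mono k (Nat.le_succ i)
  have habs : ∀ x ∈ Set.Icc a b, |x| ≤ 2 := fun x hx => by
    have := abs_le_two_of_mem_grid hi hx
    exact abs_le.2 ⟨by linarith [this.1], this.2⟩
  -- A value at `a` larger than the Lipschitz constant times the mesh keeps its sign on the whole
  -- cell. This is applied to the polynomial and to its derivative.
  have key : ∀ m : List Frac, (valueBound m : ℝ) * (1 / ((k : ℝ) + 1)) <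
      |(frac.polyDec m).eval a| → ∀ x ∈ Set.Icc a b,
      |(frac.polyDec m).eval x - (frac.polyDec m).eval a| < |(frac.polyDec m).eval a| := by
    intro m hm x hx
    refine (abs_eval_sub_le m (habs x hx) (habs a ⟨le_rfl, hab'⟩)).trans_lt (lt_of_le_of_lt ?_ hm)
    refine mul_le_mul_of_nonneg_left ?_ (Nat.cast_nonneg _)
    rw [← hab, abs_of_nonneg (by linarith [hx.1])]
    linarith [hx.2]
  rcases ((gridTest_iff l k).1 h i hi).2 with h1 | h1
  · left
    intro x hx h0
    have := key l h1 x hx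
    rw [← hp, h0, zero_sub, abs_neg] at this
    exact lt_irrefl _ this
  · right
    have hd : ∀ x ∈ Set.Icc a b,
        |(derivative p).eval x - (derivative p).eval a| < |(derivative p).eval a| := by
      have h2 := key (frac.derivCode l)
      rw [polyDec_derivCode] at h2
      exact h2 h1
    rcases le_total 0 ((derivative p).eval a) with ha | ha
    · left
      refine strictMonoOn_of_deriv_pos (convex_Icc a b) p.continuous.continuousOn fun x hx => ?_
      have := hd x (interior_subset hx)
      rw [abs_of_nonneg ha, abs_lt] at this
      rw [Polynomial.deriv]
      linarith [this.1]
    · right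
      refine strictAntiOn_of_deriv_neg (convex_Icc a b) p.continuous.continuousOn fun x hx => ?_
      have := hd x (interior_subset hx)
      rw [abs_of_nonpos ha, abs_lt] at this
      rw [Polynomial.deriv]
      linarith [this.2]

/-- By the intermediate value theorem and monotonicity, a cell is listed exactly when its part in
[0, 1] contains a root. The signs are taken at the clipped ends so that roots outside [0, 1] do not
count; the product may be 0 because 0 or 1 can be a root. -/
theorem isIsolation_gridIntervals {l : List Frac} {k : ℕ} (h : gridTest l k = true) {g : ℤ[X]}
    (hg : ∀ x : ℝ, aeval x g = 0 ↔ (frac.polyDec l).eval x = 0) :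
    IsIsolation g (gridIntervals l k) := by
  have hn : (0 : ℝ) < (k : ℝ) + 1 := by positivity
  set p := frac.polyDec l with hp
  have hend : ∀ i < k + 2, p.eval (gridFrac k i).toReal ≠ 0 ∧
      p.eval (gridFrac k (i + 1)).toReal ≠ 0 := fun i hi => ((gridTest_iff l k).1 h i hi).1
  have hsub : ∀ i < k + 2, (gridLeft k i).toReal ≤ (gridRight k i).toReal := by
    intro i hi
    have hi' : (i : ℝ) ≤ (k : ℝ) + 1 := by exact_mod_cast Nat.le_of_lt_succ hi
    rw [toReal_gridLeft, toReal_gridRight]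
    refine max_le (le_min zero_le_one ?_) (le_min ?_ (gridFrac_mono k (Nat.le_succ i)))
    · rw [toReal_gridFrac]
      push_cast
      exact div_nonneg (by linarith [Nat.cast_nonneg (α := ℝ) i]) hn.le
    · rw [toReal_gridFrac, div_le_one hn]
      linarith
  have hIcc : ∀ i, Set.Icc (gridLeft k i).toReal (gridRight k i).toReal ⊆
      Set.Icc (gridFrac k i).toReal (gridFrac k (i + 1)).toReal := by
    intro i
    rw [toReal_gridLeft, toReal_gridRight]
    exact Set.Icc_subset_Icc (le_max_right _ _) (min_le_right _ _)
  have hunit : ∀ i, Set.Icc (gridLeft k i).toReal (gridRight k i).toReal ⊆ Set.Icc 0 1 := by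
    intro i
    rw [toReal_gridLeft, toReal_gridRight]
    exact Set.Icc_subset_Icc (le_max_left _ _) (min_le_left _ _)
  refine ⟨?_, ?_, ?_, ?_⟩
  · rw [gridIntervals, List.pairwise_map]
    refine (List.pairwise_lt_range.filter _).imp fun {i j} hij => ?_
    exact gridFrac_mono k hij
  · intro J hJ
    obtain ⟨i, hi, -, rfl⟩ := (mem_gridIntervals l k J).1 hJ
    rw [Ne, Ne, hg, hg]
    exact hend i hi
  · intro J hJ
    obtain ⟨i, hi, hsign, rfl⟩ := (mem_gridIntervals l k J).1 hJ
    obtain ⟨ξ, hξ, hξ0⟩ : ∃ ξ ∈ Set.Icc (gridLeft k i).toReal (gridRight k i).toReal,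
        p.eval ξ = 0 := by
      rw [← Set.uIcc_of_le (hsub i hi)]
      refine intermediate_value_uIcc (f := fun x => p.eval x) p.continuous.continuousOn ?_
      rw [Set.mem_uIcc]
      rcases mul_nonpos_iff.1 hsign with h1 | h1
      · exact Or.inr ⟨h1.2, h1.1⟩
      · exact Or.inl h1
    have hξ' := hIcc i hξ
    refine ⟨ξ, hunit i hξ, ?_⟩
    have hinj : Set.InjOn (fun x => p.eval x)
        (Set.Icc (gridFrac k i).toReal (gridFrac k (i + 1)).toReal) := by
      rcases gridTest_cases h hi with h1 | h1 | h1
      · exact absurd hξ0 (h1 ξ hξ')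
      · exact h1.injOn
      · exact h1.injOn
    ext x
    simp only [Set.mem_ofPred_eq, Set.mem_singleton_iff, hg]
    constructor
    · rintro ⟨hx, hx0⟩
      exact hinj (Set.Ioo_subset_Icc_self hx) hξ' (hx0.trans hξ0.symm)
    · rintro rfl
      refine ⟨⟨hξ'.1.lt_of_ne ?_, hξ'.2.lt_of_ne ?_⟩, hξ0⟩
      · exact fun he => (hend i hi).1 (by rw [he, hξ0])
      · exact fun he => (hend i hi).2 (by rw [← he, hξ0])
  · intro ξ hξ hξ0
    rw [hg] at hξ0
    have hnn : 0 ≤ ξ * ((k : ℝ) + 1) + 1 / 2 := by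
      have := mul_nonneg hξ.1 hn.le
      linarith
    -- The index of the cell around ξ; the 1 / 2 undoes the shift of the grid.
    set i := ⌊ξ * ((k : ℝ) + 1) + 1 / 2⌋₊ with hi
    have h1 : (i : ℝ) ≤ ξ * ((k : ℝ) + 1) + 1 / 2 := Nat.floor_le hnn
    have h2 : ξ * ((k : ℝ) + 1) + 1 / 2 < (i : ℝ) + 1 := Nat.lt_floor_add_one _
    have hik : i < k + 2 := by
      have : (i : ℝ) < (k : ℝ) + 2 := by nlinarith [hξ.2]
      exact_mod_cast this
    have h3 : (gridFrac k i).toReal ≤ ξ := by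
      rw [toReal_gridFrac, div_le_iff₀ hn]
      linarith
    have h4 : ξ < (gridFrac k (i + 1)).toReal := by
      rw [toReal_gridFrac, lt_div_iff₀ hn]
      push_cast
      linarith
    have hξI : ξ ∈ Set.Icc (gridLeft k i).toReal (gridRight k i).toReal := by
      rw [toReal_gridLeft, toReal_gridRight]
      exact ⟨max_le hξ.1 h3, le_min hξ.2 h4.le⟩
    refine ⟨(gridFrac k i, gridFrac k (i + 1)), (mem_gridIntervals l k _).2 ⟨i, hik, ?_, rfl⟩,
      h3.lt_of_ne fun he => (hend i hik).1 (by rw [he, hξ0]), h4⟩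
    have hL := hIcc i (Set.left_mem_Icc.2 (hsub i hik))
    have hR := hIcc i (Set.right_mem_Icc.2 (hsub i hik))
    have hξJ := hIcc i hξI
    rcases gridTest_cases h hik with h5 | h5 | h5
    · exact absurd hξ0 (h5 ξ hξJ)
    · have e1 := h5.monotoneOn hL hξJ hξI.1
      have e2 := h5.monotoneOn hξJ hR hξI.2
      simp only [← hp, hξ0] at e1 e2
      exact mul_nonpos_of_nonpos_of_nonneg e1 e2
    · have e1 := h5.antitoneOn hL hξJ hξI.1
      have e2 := h5.antitoneOn hξJ hR hξI.2
      simp only [← hp, hξ0] at e1 e2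
      exact mul_nonpos_of_nonneg_of_nonpos e1 e2

/-- There are finitely many rational roots, so the product of their denominators works. -/
theorem exists_den_dvd {p : ℝ[X]} (hp : p ≠ 0) :
    ∃ D : ℕ, D ≠ 0 ∧ ∀ q : ℚ, p.eval (q : ℝ) = 0 → q.den ∣ D := by
  have hfin : {q : ℚ | p.eval (q : ℝ) = 0}.Finite := by
    refine Set.Finite.of_finite_image ((p.rootSet_finite ℝ).subset ?_)
      (Rat.cast_injective (α := ℝ)).injOn
    rintro _ ⟨q, hq, rfl⟩
    rw [mem_rootSet]
    exact ⟨hp, by simpa using hq⟩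
  refine ⟨∏ q ∈ hfin.toFinset, q.den, Finset.prod_ne_zero_iff.2 fun q _ => q.den_ne_zero,
    fun q hq => Finset.dvd_prod_of_mem _ (hfin.mem_toFinset.2 hq)⟩

/-- Coprimality excludes common zeros of p and p', so |p| + |p'| has a positive minimum δ on [-1,
2]. Once both Lipschitz constants times the mesh are below δ / 2, at each grid point p or p' is
large enough. -/
theorem exists_gridTest {l : List Frac}
    (h : IsCoprime (frac.polyDec l) (derivative (frac.polyDec l))) :
    ∃ k, gridTest l k = true := by
  set p := frac.polyDec l with hp
  have hp0 : p ≠ 0 := by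
    intro h0
    rw [h0, derivative_zero] at h
    exact not_isCoprime_zero_zero h
  obtain ⟨D, hD0, hD⟩ := exists_den_dvd hp0
  obtain ⟨c, hc, hmin⟩ := (isCompact_Icc (a := (-1 : ℝ)) (b := 2)).exists_isMinOn
    ⟨0, by norm_num⟩ (f := fun x => |p.eval x| + |(derivative p).eval x|)
    (p.continuous.abs.add (derivative p).continuous.abs).continuousOn
  set δ := |p.eval c| + |(derivative p).eval c| with hδ
  have hδ0 : 0 < δ := by
    refine lt_of_le_of_ne (by positivity) fun h0 => ?_
    have h1 : |p.eval c| = 0 := by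
      linarith [abs_nonneg (p.eval c), abs_nonneg ((derivative p).eval c)]
    have h2 : |(derivative p).eval c| = 0 := by linarith
    obtain ⟨a, b, hab⟩ := h
    have := congrArg (eval c) hab
    rw [eval_add, eval_mul, eval_mul, abs_eq_zero.1 h1, abs_eq_zero.1 h2] at this
    simp at this
  set V : ℝ := valueBound l + valueBound (frac.derivCode l) with hV
  obtain ⟨M, hM⟩ := exists_nat_gt (2 * V / δ)
  have hM' : 2 * V < M * δ := (div_lt_iff₀ hδ0).1 hM
  -- The number k + 1 has to be large and also a multiple of all denominators of rational roots.
  obtain ⟨k, hk⟩ : ∃ k, k + 1 = D * (M + 1) :=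
    ⟨D * (M + 1) - 1, Nat.succ_pred_eq_of_ne_zero (mul_ne_zero hD0 (Nat.succ_ne_zero M))⟩
  have hkR : (k : ℝ) + 1 = D * (M + 1) := by exact_mod_cast hk
  have hn : (0 : ℝ) < (k : ℝ) + 1 := by positivity
  have hkM : (M : ℝ) ≤ (k : ℝ) + 1 := by
    have : M ≤ k + 1 := by
      rw [hk]
      nlinarith [Nat.pos_of_ne_zero hD0]
    exact_mod_cast this
  have hpt : ∀ i, p.eval (gridFrac k i).toReal ≠ 0 := by
    intro i h0
    set q : ℚ := ((i : ℚ) - 1 / 2) / ((k : ℚ) + 1) with hq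
    have hqr : (gridFrac k i).toReal = (q : ℝ) := by
      rw [toReal_gridFrac, hq]
      push_cast
      ring
    rw [hqr] at h0
    -- If the grid point q were a root, q(k + 1) = i - 1/2 would be an integer.
    obtain ⟨e, he⟩ : q.den ∣ k + 1 := hk ▸ (hD q h0).mul_right _
    have h1 : (q.num : ℚ) = q * q.den := (Rat.mul_den_eq_num q).symm
    have h2 : q * ((k : ℚ) + 1) = (i : ℚ) - 1 / 2 := by
      rw [hq]
      exact div_mul_cancel₀ _ (by positivity)
    have h3 : (k : ℚ) + 1 = q.den * e := by exact_mod_cast he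
    have h4 : 2 * (q.num : ℚ) * e = 2 * i - 1 := by
      rw [h1]
      rw [h3] at h2
      linear_combination 2 * h2
    have h5 : 2 * q.num * (e : ℤ) = 2 * (i : ℤ) - 1 := by exact_mod_cast h4
    have h6 : 2 * (q.num * (e : ℤ)) = 2 * (i : ℤ) - 1 := by rw [← h5]; ring
    omega
  refine ⟨k, (gridTest_iff l k).2 fun i hi => ⟨⟨hpt i, hpt (i + 1)⟩, ?_⟩⟩
  have hmem := abs_le_two_of_mem_grid hi
    (Set.left_mem_Icc.2 (gridFrac_mono k (Nat.le_succ i)))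
  have hle : δ ≤ |p.eval (gridFrac k i).toReal| + |(derivative p).eval (gridFrac k i).toReal| :=
    hmin hmem
  have hVδ : V * (1 / ((k : ℝ) + 1)) < δ / 2 := by
    rw [mul_one_div, div_lt_iff₀ hn]
    nlinarith
  have hinv : 0 < 1 / ((k : ℝ) + 1) := by positivity
  have hb1 : (valueBound l : ℝ) * (1 / ((k : ℝ) + 1)) ≤ V * (1 / ((k : ℝ) + 1)) := by
    refine mul_le_mul_of_nonneg_right ?_ hinv.le
    simp [hV]
  have hb2 : (valueBound (frac.derivCode l) : ℝ) * (1 / ((k : ℝ) + 1)) ≤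
      V * (1 / ((k : ℝ) + 1)) := by
    refine mul_le_mul_of_nonneg_right ?_ hinv.le
    simp [hV]
  by_contra hno
  rw [not_or, not_lt, not_lt] at hno
  linarith [hno.1, hno.2]

/-! ### Primitive recursiveness of the grid functions -/

theorem primrec_gridFrac : Primrec₂ gridFrac :=
  Primrec.pair (Primrec.int_natSub.comp (Primrec.nat_double.comp Primrec.snd) (.const 1))
    (Primrec.nat_double_succ.comp Primrec.fst)

theorem primrec_gridLeft : Primrec₂ gridLeft :=
  Primrec.pair (Primrec.int_ofNat.comp
    (Primrec.nat_sub.comp (Primrec.nat_double.comp Primrec.snd) (.const 1)))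
    (Primrec.nat_double_succ.comp Primrec.fst)

theorem primrec_gridRight : Primrec₂ gridRight :=
  Primrec.pair (Primrec.int_ofNat.comp
    (Primrec.nat_min.comp (Primrec.nat_double_succ.comp Primrec.snd)
      (Primrec.succ.comp (Primrec.nat_double_succ.comp Primrec.fst))))
    (Primrec.nat_double_succ.comp Primrec.fst)

theorem primrec_largeTest {γ : Type*} [Primcodable γ] {V k : γ → ℕ} {r : γ → Frac}
    (hV : Primrec V) (hk : Primrec k) (hr : Primrec r) :
    Primrec fun g => largeTest (V g) (k g) (r g) :=
  primrecPred_iff_primrec_decide.1 (PrimrecRel.comp Primrec.nat_lt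
    (Primrec.nat_mul.comp hV (Primrec.succ.comp (Primrec.snd.comp hr)))
    (Primrec.nat_mul.comp (Primrec.int_natAbs.comp (Primrec.fst.comp hr)) (Primrec.succ.comp hk)))

theorem primrec_gridTest : Primrec₂ gridTest := by
  have hl := Primrec.fst.comp (Primrec.fst (α := List Frac × ℕ) (β := ℕ))
  have hk := Primrec.snd.comp (Primrec.fst (α := List Frac × ℕ) (β := ℕ))
  have hi := Primrec.snd (α := List Frac × ℕ) (β := ℕ)
  have hd := frac.primrec_derivCode.comp hl
  have e1 := primrec_gridFrac.comp hk hi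
  have e2 := primrec_gridFrac.comp hk (Primrec.succ.comp hi)
  have v1 := frac.primrec_evalCode.comp e1 hl
  refine Primrec.list_all (Primrec.list_range.comp
    (Primrec.succ.comp (Primrec.succ.comp Primrec.snd))) (Primrec.and.comp (Primrec.and.comp
      (Primrec.not.comp (frac.primrec_isZero.comp v1))
      (Primrec.not.comp (frac.primrec_isZero.comp (frac.primrec_evalCode.comp e2 hl))))
      (Primrec.or.comp (primrec_largeTest (primrec_valueBound.comp hl) hk v1)
        (primrec_largeTest (primrec_valueBound.comp hd) hk
          (frac.primrec_evalCode.comp e1 hd)))).to₂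

theorem primrec_gridIntervals : Primrec₂ gridIntervals := by
  have hl := Primrec.fst.comp (Primrec.fst (α := List Frac × ℕ) (β := ℕ))
  have hk := Primrec.snd.comp (Primrec.fst (α := List Frac × ℕ) (β := ℕ))
  have hi := Primrec.snd (α := List Frac × ℕ) (β := ℕ)
  refine Primrec.list_map (Primrec.list_filter (Primrec.list_range.comp
    (Primrec.succ.comp (Primrec.succ.comp Primrec.snd)))
    (primrec_fracLe.comp (frac.primrec_mul.comp
      (frac.primrec_evalCode.comp (primrec_gridLeft.comp hk hi) hl)
      (frac.primrec_evalCode.comp (primrec_gridRight.comp hk hi) hl)) (.const _)).to₂)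
    (Primrec.pair (primrec_gridFrac.comp hk hi)
      (primrec_gridFrac.comp hk (Primrec.succ.comp hi))).to₂

/-! ### Reduction to squarefree polynomials -/

theorem exists_polyDec_frac (p : ℚ[X]) : ∃ l, frac.polyDec l = p.map (algebraMap ℚ ℝ) := by
  choose c hc using exists_frac_toReal
  refine ⟨(List.range (p.natDegree + 1)).map fun i => c (p.coeff i), ?_⟩
  ext n
  rw [coeff_polyDec, getD_map_range, coeff_map]
  split_ifs with h
  · exact hc _
  · rw [coeff_eq_zero_of_natDegree_lt (by omega), map_zero, frac.dec_zero]

/-- The coefficient list of an integer polynomial, the leading coefficient first, as a code of a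
real polynomial. -/
def intListCode (l : List ℤ) : List Frac := l.reverse.map fun z => (z, 0)

theorem polyDec_intListCode (l : List ℤ) :
    frac.polyDec (intListCode l) = (int.polyDec l.reverse).map (algebraMap ℤ ℝ) :=
  polyDec_map int (fun z => by simp [frac_dec, Frac.toReal]) _

theorem primrec_intListCode : Primrec intListCode :=
  Primrec.list_map Primrec.list_reverse (Primrec.pair Primrec.snd (.const 0)).to₂

/-- Whether the first list codes a polynomial `h` with `h u = g` and `g v = h ^ m`, and the grid of
mesh `1 / (k + 1)` is fine enough to isolate the roots of `h`. -/
noncomputable def isolationTest (l : List ℤ)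
    (b : (List Frac × ℕ) × (List Frac × List Frac × ℕ)) : Bool :=
  int.poly.isZero l.reverse ||
    (gridTest b.1.1 b.1.2 && (frac.poly.eqCode (frac.polyMul b.1.1 b.2.1) (intListCode l) &&
      frac.poly.eqCode (frac.polyMul (intListCode l) b.2.2.1) (frac.poly.powCode b.1.1 b.2.2.2)))

theorem primrec_isolationTest : Primrec₂ isolationTest := by
  let β := (List Frac × ℕ) × (List Frac × List Frac × ℕ)
  have hl := Primrec.fst (α := List ℤ) (β := β)
  have hb := Primrec.snd (α := List ℤ) (β := β)
  have hh := Primrec.fst.comp (Primrec.fst.comp hb)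
  have hg := primrec_intListCode.comp hl
  have huv := Primrec.snd.comp hb
  refine Primrec.or.comp (int.poly.primrec_isZero.comp (Primrec.list_reverse.comp hl))
    (Primrec.and.comp (primrec_gridTest.comp hh (Primrec.snd.comp (Primrec.fst.comp hb)))
      (Primrec.and.comp
        (frac.poly.primrec_eqCode.comp
          (frac.primrec_polyMul.comp hh (Primrec.fst.comp huv)) hg)
        (frac.poly.primrec_eqCode.comp
          (frac.primrec_polyMul.comp hg (Primrec.fst.comp (Primrec.snd.comp huv)))
          (frac.poly.primrec_powCode.comp hh (Primrec.snd.comp (Primrec.snd.comp huv))))))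

theorem exists_isolationTest (l : List ℤ) : ∃ b, isolationTest l b = true := by
  by_cases hl : int.polyDec l.reverse = 0
  -- The zero polynomial passes with any certificate, to make the search total.
  · refine ⟨default, ?_⟩
    rw [isolationTest, (int.poly.isZero_iff _).2 hl, Bool.true_or]
  set g := (int.polyDec l.reverse).map (algebraMap ℤ ℚ) with hg
  have hg0 : g ≠ 0 := (Polynomial.map_ne_zero_iff (Int.cast_injective (α := ℚ))).2 hl
  -- A squarefree y with y ∣ g ∣ y^m; over ℚ it is separable, so it stays coprime to its derivative
  -- over ℝ and has a fine enough grid.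
  obtain ⟨y, m, hy, ⟨u, hu⟩, ⟨v, hv⟩⟩ := exists_squarefree_dvd_pow_of_ne_zero hg0
  obtain ⟨y', hy'⟩ := exists_polyDec_frac y
  obtain ⟨u', hu'⟩ := exists_polyDec_frac u
  obtain ⟨v', hv'⟩ := exists_polyDec_frac v
  have hg' : frac.polyDec (intListCode l) = g.map (algebraMap ℚ ℝ) := by
    rw [polyDec_intListCode, hg, Polynomial.map_map]
    congr 1
  obtain ⟨k, hk⟩ := exists_gridTest (l := y') (by
    rw [hy']
    exact (PerfectField.separable_iff_squarefree.2 hy).map)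
  refine ⟨((y', k), (u', v', m)), ?_⟩
  simp only [isolationTest, hk, Bool.true_and, Bool.or_eq_true, Bool.and_eq_true, eqCode_iff,
    poly_dec, polyDec_polyMul]
  right
  rw [hy', hu', hv', hg', ← Polynomial.map_mul, ← hu, ← Polynomial.map_mul, ← hv,
    Polynomial.map_pow, ← hy']
  exact ⟨rfl, (frac.poly.dec_powCode y' m).symm⟩

/-- The identities h u = g and g v = h^m give g and h the same real roots. Squarefreeness of h need
not be checked, since the grid test is sufficient by itself. -/
theorem isolationTest_sound {g : ℤ[X]} (hg : g ≠ 0)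
    {b : (List Frac × ℕ) × (List Frac × List Frac × ℕ)}
    (h : isolationTest g.coeffList b = true) : IsIsolation g (gridIntervals b.1.1 b.1.2) := by
  have hz : ¬ int.poly.isZero g.coeffList.reverse = true := by
    rw [int.poly.isZero_iff, poly_dec, polyDec_reverse_coeffList]
    exact hg
  rw [isolationTest, Bool.not_eq_true _ |>.mp hz, Bool.false_or, Bool.and_eq_true, Bool.and_eq_true,
    eqCode_iff, eqCode_iff, dec_powCode, poly_dec, poly_dec, poly_dec, poly_dec, polyDec_polyMul,
    polyDec_polyMul, polyDec_intListCode, polyDec_reverse_coeffList] at h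
  obtain ⟨hgrid, hu, hv⟩ := h
  refine isIsolation_gridIntervals hgrid fun x => ?_
  have hx : aeval x g = (g.map (algebraMap ℤ ℝ)).eval x := by
    rw [eval_map_algebraMap]
  rw [hx]
  constructor
  · intro h0
    have := congrArg (eval x) hv
    rw [eval_mul, h0, zero_mul, eval_pow] at this
    exact eq_zero_of_pow_eq_zero this.symm
  · intro h0
    rw [← hu, eval_mul, h0, zero_mul]

theorem exists_isRootIsolator : ∃ iso, IsRootIsolator iso := by
  obtain ⟨f, hf, hfR⟩ := exists_computable_of_test primrec_isolationTest.to_comp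
    exists_isolationTest
  exact ⟨fun l => gridIntervals (f l).1.1 (f l).1.2,
    primrec_gridIntervals.to_comp.comp (Computable.fst.comp (Computable.fst.comp hf))
      (Computable.snd.comp (Computable.fst.comp hf)),
    fun g hg => isolationTest_sound hg (hfR g.coeffList)⟩

end Grid

theorem mainTheorem1 :
    -- the conjugate product vanishes at all roots, for each selection of square roots
    (∀ (p q : QString) (s : ℂ → ℂ), (∀ z, s z ^ 2 = z) → ∀ ξ : ℂ,
      stringFunC s (mulInv p q) ξ - ξ = 0 → aeval ξ (conjugateProduct (mulInv p q)) = 0) ∧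
    -- `f` is the conjugate product, if this is not the zero polynomial
    (∀ p q : QString, conjugateProduct (mulInv p q) ≠ 0 →
      rootPoly (mulInv p q) = conjugateProduct (mulInv p q)) ∧
    -- `f` is not the zero polynomial, and it vanishes at all roots of `I_{p q⁻¹}(x) - x` in
    -- `[0, 1]`, unless this function is identically zero
    (∀ p q : QString, rootPoly (mulInv p q) ≠ 0 ∧
      ((∃ x ∈ Set.Icc (0 : ℝ) 1, stringFun (mulInv p q) x - x ≠ 0) →
        ∀ ξ ∈ Set.Icc (0 : ℝ) 1, stringFun (mulInv p q) ξ - ξ = 0 →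
          aeval ξ (rootPoly (mulInv p q)) = 0)) ∧
    -- each step of the procedure is effective
    (Computable fun pq : QString × QString => (rootPoly (mulInv pq.1 pq.2)).coeffList) ∧
    (∃ iso, IsRootIsolator iso) ∧
    (∃ sgn, IsSignTest sgn) ∧
    -- the procedure terminates and decides the inequality
    (∀ iso sgn, IsRootIsolator iso → IsSignTest sgn →
      (Computable fun pq : QString × QString => procedure iso sgn pq.1 pq.2) ∧
      ∀ p q : QString, procedure iso sgn p q = true ↔
        ∀ x ∈ Set.Icc (0 : ℝ) 1, stringFun p x ≥ stringFun q x) :=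
  ⟨fun p q _ hs ξ h => aeval_conjugateProduct hs (mulInv p q) ξ h,
    fun _ _ h => rootPoly_eq_conjugateProduct h,
    fun p q => ⟨rootPoly_ne_zero (mulInv p q), fun h _ hξ h0 => aeval_rootPoly h hξ h0⟩,
    (primrec_coeffList_rootPoly.comp primrec_mulInv).to_comp,
    exists_isRootIsolator, exists_isSignTest,
    fun _ _ hiso hsgn => ⟨computable_procedure hiso.1 hsgn.1, procedure_eq_true_iff hiso hsgn⟩⟩
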